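/- Let $\{B(t)\}_{t\ge 0}$ be a one-dimensional standard Brownian motion on a probability space $(\Omega,\mathcal F,\mathbb P)$. Let $a,c\in\mathbb R$ with $c<-a-c<a$ (so $c<0<a$), put $\mathcal B=(a^2+c^2+ac)/3$, and let $y\in[c,-a-c]$ and $\eta\in\mathbb R$ satisfy $$\frac{\eta^2}{2}-\frac{y^3}{3}+\mathcal B y=\frac{ac(a+c)}{3}.$$ Let $x_0$ be the solution on $[0,\infty)$ of $$\ddot x_0=x_0^2-\mathcal B,\qquad x_0(0)=y,\quad \dot x_0(0)=\eta .$$ Let the processes $x_n$, $n\ge 1$, on $[0,\infty)$ be the solutions (almost surely, pathwise) of $$\ddot x_1(t)=2x_0(t)x_1(t)+\dot B(t),\qquad x_1(0)=\dot x_1(0)=0,$$ understood as $dx_1=\xi_1\,dt$, $d\xi_1=2x_0x_1\,dt+dB$, $x_1(0)=\xi_1(0)=0$, and, for $n\ge 2$, $$\ddot x_n(t)=2x_0(t)x_n(t)+\sum_{j=1}^{n-1}x_j(t)x_{n-j}(t),\qquad x_n(0)=\dot x_n(0)=0 .$$ Let $q=\sqrt{(2c+a)/(c-a)}\in(0,1)$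 and $F(\varphi,q)=\int_0^\varphi(1-q^2\sin^2\alpha)^{-1/2}\,d\alpha$, let $\mathrm{sn},\mathrm{cn},\mathrm{dn}$ be the Jacobi elliptic functions and $\mathcal E(t,q)=\int_0^t\mathrm{dn}^2(s,q)\,ds$. Put $$u_1(t)=\mathrm{sn}(t,q)\,\mathrm{cn}(t,q)\,\mathrm{dn}(t,q),$$ $$\begin{aligned}u_2(t)={}&(-1+q^2)+(-2q^6+3q^4-5q^2+2)\,\mathrm{cn}^2(t,q)+2q^2(q^4-q^2+1)\,\mathrm{cn}^4(t,q)\\&+\big[(-q^4+3q^2-2)\,t+2(q^4-q^2+1)\,\mathcal E(t,q)\big]u_1(t),\end{aligned}$$ and, for $i=1,2$, $$w_i(t)=k_i\,u_i\Big(\sqrt{\tfrac{a-c}{6}}\;t+\theta\Big),\qquad \theta=\pm F\Big(\arcsin\sqrt{\tfrac{c-y}{2c+a}},\,q\Big),$$ where the sign is $+$ if $\eta\ge 0$ and $-$ if $\eta<0$, and where $k_1,k_2\in\mathbb R$ are constants such that the Wronskian $w_1\dot w_2-\dot w_1w_2$ equals $1$. (These are linearly independent solutions of $\ddot w=2x_0w$.)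 Put $K(t,s)=w_2(t)w_1(s)-w_1(t)w_2(s)$ and define, for $t\ge 0$, $$\gamma_1(t)=|w_1(t)|+|w_2(t)|,\qquad \gamma_n(t)=\int_0^t|K(t,s)|\sum_{j=1}^{n-1}\gamma_j(s)\gamma_{n-j}(s)\,ds\quad(n\ge 2).$$ Then for every $\sigma>0$, $T>0$ and $n\ge 1$, $$\mathbb P\Big(|x_n(t)|\le\frac{\gamma_n(t)}{\sigma^n}\ \text{for all } t\in[0,T]\Big)\ \ge\ 1-\sigma\,2^{(n-2)^+}\sqrt{\frac{2}{\pi}}\,\Big(\|w_1\|_{L^2([0,T])}+\|w_2\|_{L^2([0,T])}\Big),$$ where $(n-2)^+=\max\{n-2,0\}$. -/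

import Mathlib

open MeasureTheory ProbabilityTheory Set
open scoped NNReal

noncomputable section

namespace CubicOscillator

/-- The elliptic integral of the first kind `F(φ, q) = ∫₀^φ dα / √(1 - q² sin² α)`. -/
def ellipticF (φ q : ℝ) : ℝ :=
  ∫ α in (0 : ℝ)..φ, 1 / Real.sqrt (1 - q ^ 2 * Real.sin α ^ 2)

/-- The Jacobi amplitude: the inverse function of `φ ↦ F(φ, q)`, which for `0 < q < 1` is a
bijection of `ℝ`. -/
def am (u q : ℝ) : ℝ := Function.invFun (fun φ : ℝ => ellipticF φ q) u

/-- The Jacobi elliptic sine: `sn(u, q) = sin φ` where `u = F(φ, q)`. -/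
def sn (u q : ℝ) : ℝ := Real.sin (am u q)

/-- The Jacobi elliptic cosine. -/
def cn (u q : ℝ) : ℝ := Real.cos (am u q)

/-- The Jacobi delta amplitude. -/
def dn (u q : ℝ) : ℝ := Real.sqrt (1 - q ^ 2 * sn u q ^ 2)

/-- Jacobi's epsilon function. -/
def jacobiEpsilon (u q : ℝ) : ℝ := ∫ s in (0 : ℝ)..u, dn s q ^ 2

/-- The first solution of Lamé's equation `u'' + (4 + 4 q² - 12 q² sn²(t, q)) u = 0`. -/
def u₁ (q t : ℝ) : ℝ := sn t q * cn t q * dn t q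

/-- The second solution of the same equation. -/
def u₂ (q t : ℝ) : ℝ :=
  (-1 + q ^ 2) + (-2 * q ^ 6 + 3 * q ^ 4 - 5 * q ^ 2 + 2) * cn t q ^ 2
    + 2 * q ^ 2 * (q ^ 4 - q ^ 2 + 1) * cn t q ^ 4
    + ((-q ^ 4 + 3 * q ^ 2 - 2) * t + 2 * (q ^ 4 - q ^ 2 + 1) * jacobiEpsilon t q) * u₁ q t

/-- The Hamiltonian `H(x, ξ) = ξ²/2 - x³/3 + 𝓑 x`. -/
def hamiltonian (b x ξ : ℝ) : ℝ := ξ ^ 2 / 2 - x ^ 3 / 3 + b * x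

/-- The constant `𝓑 = (a² + c² + ac)/3`. -/
def calB (a c : ℝ) : ℝ := (a ^ 2 + c ^ 2 + a * c) / 3

/-- The modulus `q = √((2c + a)/(c - a))`. -/
def modulus (a c : ℝ) : ℝ := Real.sqrt ((2 * c + a) / (c - a))

/-- The phase at time `0`, of absolute value `F(arcsin √((c - y)/(2c + a)), q)` and with the sign
of the initial velocity `η` (the sign is `+` if `η = 0`). -/
def phase (a c y η : ℝ) : ℝ :=
  if η < 0 then -ellipticF (Real.arcsin (Real.sqrt ((c - y) / (2 * c + a)))) (modulus a c)
  else ellipticF (Real.arcsin (Real.sqrt ((c - y) / (2 * c + a)))) (modulus a c)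

/-- `t ↦ k · u₁(√((a - c)/6) t + i)`, with `i` the phase and `k` a normalizing constant. -/
def w₁ (a c y η k t : ℝ) : ℝ :=
  k * u₁ (modulus a c) (Real.sqrt ((a - c) / 6) * t + phase a c y η)

/-- `t ↦ k · u₂(√((a - c)/6) t + i)`, with `i` the phase and `k` a normalizing constant. -/
def w₂ (a c y η k t : ℝ) : ℝ :=
  k * u₂ (modulus a c) (Real.sqrt ((a - c) / 6) * t + phase a c y η)

/-- `x₀` solves `x₀' = ξ₀`, `ξ₀' = x₀² - 𝓑` on `[0, ∞)` with `x₀(0) = y`, `ξ₀(0) = η`. -/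
def IsUnperturbedSolution (b y η : ℝ) (x₀ : ℝ → ℝ) : Prop :=
  ∃ ξ₀ : ℝ → ℝ, x₀ 0 = y ∧ ξ₀ 0 = η ∧
    (∀ t, 0 ≤ t → HasDerivWithinAt x₀ (ξ₀ t) (Ici 0) t) ∧
    (∀ t, 0 ≤ t → HasDerivWithinAt ξ₀ (x₀ t ^ 2 - b) (Ici 0) t)

/-- The path `x` solves on `[0, ∞)` the system `dx = ξ dt`, `dξ = 2 x₀ x dt + dF`, `x(0) = 0`,
`ξ(0) = 0`, in integrated form; here `F` is a continuous path with `F(0) = 0`. -/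
def SolvesLinearized (x₀ F x : ℝ → ℝ) : Prop :=
  ∃ ξ : ℝ → ℝ, ContinuousOn ξ (Ici 0) ∧
    (∀ t, 0 ≤ t → x t = ∫ s in (0 : ℝ)..t, ξ s) ∧
    (∀ t, 0 ≤ t → ξ t = (∫ s in (0 : ℝ)..t, 2 * x₀ s * x s) + F t)

/-- The processes `x₁, x₂, …` are the coefficients of the expansion in the noise intensity: almost
surely, `x₁'' = 2 x₀ x₁ + dB/dt` and `xₙ'' = 2 x₀ xₙ + ∑_{1 ≤ j ≤ n - 1} x_j x_{n - j}` for
`n ≥ 2`, all with zero initial data. (The value `x 0` plays no role.) -/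
structure IsExpansion {Ω : Type*} [MeasurableSpace Ω] (P : Measure Ω) (B : ℝ≥0 → Ω → ℝ)
    (x₀ : ℝ → ℝ) (x : ℕ → ℝ → Ω → ℝ) : Prop where
  first : ∀ᵐ ω ∂P, SolvesLinearized x₀ (fun t => B t.toNNReal ω) (fun t => x 1 t ω)
  higher : ∀ n : ℕ, 2 ≤ n → ∀ᵐ ω ∂P, SolvesLinearized x₀
    (fun t => ∫ s in (0 : ℝ)..t, ∑ j ∈ Finset.Ico 1 n, x j s ω * x (n - j) s ω)
    (fun t => x n t ω)

/-- The kernel `K(t, s) = w₂(t) w₁(s) - w₁(t) w₂(s)`. -/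
def kernel (v₁ v₂ : ℝ → ℝ) (t s : ℝ) : ℝ := v₂ t * v₁ s - v₁ t * v₂ s

/-- `γ₁ = |w₁| + |w₂|` and, for `n ≥ 2`,
`γₙ(t) = ∫₀ᵗ |K(t, s)| ∑_{1 ≤ j ≤ n - 1} γ_j(s) γ_{n - j}(s) ds`; see `gammaSeq_of_two_le`.
(The value at index `0` plays no role.) -/
def gammaSeq (v₁ v₂ : ℝ → ℝ) : ℕ → ℝ → ℝ
  | 0 => fun _ => 0
  | 1 => fun t => |v₁ t| + |v₂ t|
  | n + 2 => fun t => ∫ s in (0 : ℝ)..t, |kernel v₁ v₂ t s| *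
      ∑ j : Fin (n + 1), gammaSeq v₁ v₂ (1 + j) s * gammaSeq v₁ v₂ (n + 2 - (1 + j)) s
termination_by n => n
decreasing_by all_goals omega

theorem gammaSeq_of_two_le (v₁ v₂ : ℝ → ℝ) (n : ℕ) (hn : 2 ≤ n) (t : ℝ) :
    gammaSeq v₁ v₂ n t = ∫ s in (0 : ℝ)..t, |kernel v₁ v₂ t s| *
      ∑ j ∈ Finset.Ico 1 n, gammaSeq v₁ v₂ j s * gammaSeq v₁ v₂ (n - j) s := by
  obtain ⟨m, rfl⟩ := Nat.exists_eq_add_of_le' hn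
  rw [gammaSeq]
  refine intervalIntegral.integral_congr fun s _ => ?_
  congr 1
  rw [Finset.sum_Ico_eq_sum_range, Finset.sum_range]
  rfl

/-- The norm of `L²([0, T])`. -/
def L2norm (T : ℝ) (f : ℝ → ℝ) : ℝ := (eLpNorm f 2 (volume.restrict (Icc 0 T))).toReal

end CubicOscillator

end

/-! The level `a * c * (a + c) / 3` makes the energy cubic factor as `(x - a) (x - c) (x + a + c) /
3`, so the orbit oscillates between `c` and `-a - c` and is an explicit affine function of `sn ^ 2`.
The linearization `w'' = 2 x₀ w` then becomes Lamé's equation, solved by `w₁` and `w₂`. With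
Wronskian 1, variation of constants, done pathwise with integration by parts in place of stochastic
calculus, gives `x₁ = w₂ ∫ w₁ dB - w₁ ∫ w₂ dB` and `xₙ(t) = ∫ K(t, s) ∑ x_j x_{n - j} ds`.

If both Wiener integrals stay within `1 / σ` on `[0, T]`, then `|x₁| ≤ γ₁ / σ`. The recursion is
homogeneous, so induction gives `|xₙ| ≤ γₙ / σ ^ n` for all `n` on that same event
(`abs_le_gammaSeq_div`), with no further loss of probability.

Each Wiener integral leaves the band with probability at most `σ √(2/π) ‖wᵢ‖`
(`measureReal_exists_lt_abs_pathIntegral_le`). This is Doob's `L¹` maximal inequality for Riemann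
sums, which are sums of independent centred Gaussians, together with `E|N(0, v)| = √(2 v / π)` and
passage to the limit. -/

namespace CubicOscillator

/-! ### Jacobi elliptic functions and Lamé's equation -/

section Jacobi

variable {q : ℝ}

theorem one_sub_sq_mul_sin_sq_pos (hq0 : 0 ≤ q) (hq1 : q < 1) (α : ℝ) :
    0 < 1 - q ^ 2 * Real.sin α ^ 2 := by
  have h1 : Real.sin α ^ 2 ≤ 1 := Real.sin_sq_le_one α
  have h2 : q ^ 2 < 1 := by nlinarith
  nlinarith [sq_nonneg q, sq_nonneg (Real.sin α)]

theorem continuous_ellipticF_integrand (hq0 : 0 ≤ q) (hq1 : q < 1) :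
    Continuous fun α : ℝ => 1 / Real.sqrt (1 - q ^ 2 * Real.sin α ^ 2) := by
  refine continuous_const.div (by fun_prop) fun α => ?_
  exact (Real.sqrt_pos.2 (one_sub_sq_mul_sin_sq_pos hq0 hq1 α)).ne'

theorem hasDerivAt_ellipticF (hq0 : 0 ≤ q) (hq1 : q < 1) (φ : ℝ) :
    HasDerivAt (fun φ => ellipticF φ q) (1 / Real.sqrt (1 - q ^ 2 * Real.sin φ ^ 2)) φ :=
  intervalIntegral.integral_hasDerivAt_right
    ((continuous_ellipticF_integrand hq0 hq1).intervalIntegrable _ _)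
    ((continuous_ellipticF_integrand hq0 hq1).stronglyMeasurableAtFilter _ _)
    (continuous_ellipticF_integrand hq0 hq1).continuousAt

theorem ellipticF_zero (q : ℝ) : ellipticF 0 q = 0 := by simp [ellipticF]

theorem ellipticF_neg (φ q : ℝ) : ellipticF (-φ) q = -ellipticF φ q := by
  have h := intervalIntegral.integral_comp_neg (a := 0) (b := φ)
    (fun α : ℝ => 1 / Real.sqrt (1 - q ^ 2 * Real.sin α ^ 2))
  simp only [Real.sin_neg, neg_sq, neg_zero] at h
  rw [ellipticF, ellipticF, h, intervalIntegral.integral_symm]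

theorem strictMono_ellipticF (hq0 : 0 ≤ q) (hq1 : q < 1) :
    StrictMono fun φ => ellipticF φ q := by
  refine strictMono_of_deriv_pos fun φ => ?_
  rw [(hasDerivAt_ellipticF hq0 hq1 φ).deriv]
  exact one_div_pos.2 (Real.sqrt_pos.2 (one_sub_sq_mul_sin_sq_pos hq0 hq1 φ))

/-- The integrand is at least 1. Hence `F` dominates the identity at both ends of the line, which
makes it surjective. -/
theorem monotone_ellipticF_sub_id (hq0 : 0 ≤ q) (hq1 : q < 1) :
    Monotone fun φ => ellipticF φ q - φ := by
  refine monotone_of_hasDerivAt_nonneg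
    (f' := fun φ => 1 / Real.sqrt (1 - q ^ 2 * Real.sin φ ^ 2) - 1)
    (fun φ => (hasDerivAt_ellipticF hq0 hq1 φ).sub (hasDerivAt_id φ)) fun φ => ?_
  have h0 := Real.sqrt_pos.2 (one_sub_sq_mul_sin_sq_pos hq0 hq1 φ)
  have h1 : Real.sqrt (1 - q ^ 2 * Real.sin φ ^ 2) ≤ 1 := by
    refine Real.sqrt_le_one.2 ?_
    nlinarith [mul_nonneg (sq_nonneg q) (sq_nonneg (Real.sin φ))]
  exact sub_nonneg.2 ((one_le_div h0).2 h1)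

theorem continuous_ellipticF (hq0 : 0 ≤ q) (hq1 : q < 1) :
    Continuous fun φ => ellipticF φ q :=
  continuous_iff_continuousAt.2 fun φ => (hasDerivAt_ellipticF hq0 hq1 φ).continuousAt

theorem surjective_ellipticF (hq0 : 0 ≤ q) (hq1 : q < 1) :
    Function.Surjective fun φ => ellipticF φ q := by
  have hm := monotone_ellipticF_sub_id hq0 hq1
  refine (continuous_ellipticF hq0 hq1).surjective ?_ ?_
  · refine Filter.tendsto_atTop_mono' _ ?_ Filter.tendsto_id
    filter_upwards [Filter.eventually_ge_atTop 0] with φ hφ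
    have := hm hφ
    simp only [ellipticF_zero] at this
    simp only [id]; linarith
  · refine Filter.tendsto_atBot_mono' _ ?_ Filter.tendsto_id
    filter_upwards [Filter.eventually_le_atBot 0] with φ hφ
    have := hm hφ
    simp only [ellipticF_zero] at this
    simp only [id]; linarith

theorem am_ellipticF (hq0 : 0 ≤ q) (hq1 : q < 1) (φ : ℝ) : am (ellipticF φ q) q = φ :=
  Function.leftInverse_invFun (strictMono_ellipticF hq0 hq1).injective φ

theorem ellipticF_am (hq0 : 0 ≤ q) (hq1 : q < 1) (u : ℝ) : ellipticF (am u q) q = u :=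
  Function.rightInverse_invFun (surjective_ellipticF hq0 hq1) u

/-- A strictly monotone surjection is an order isomorphism, so its inverse is continuous; the
inverse function rule for `am` needs this. -/
theorem continuous_am (hq0 : 0 ≤ q) (hq1 : q < 1) : Continuous fun u => am u q := by
  let e := (strictMono_ellipticF hq0 hq1).orderIsoOfSurjective _ (surjective_ellipticF hq0 hq1)
  have h : (fun u => am u q) = e.symm := by
    funext u
    rw [OrderIso.eq_symm_apply]
    exact ellipticF_am hq0 hq1 u
  rw [h]
  exact e.symm.continuous

theorem hasDerivAt_am (hq0 : 0 ≤ q) (hq1 : q < 1) (u : ℝ) :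
    HasDerivAt (fun u => am u q) (dn u q) u := by
  have h := (hasDerivAt_ellipticF hq0 hq1 (am u q)).of_local_left_inverse
    (continuous_am hq0 hq1).continuousAt
    (one_div_pos.2 (Real.sqrt_pos.2 (one_sub_sq_mul_sin_sq_pos hq0 hq1 _))).ne'
    (Filter.Eventually.of_forall (ellipticF_am hq0 hq1))
  simpa [dn, sn] using h

theorem sn_sq_add_cn_sq (u q : ℝ) : sn u q ^ 2 + cn u q ^ 2 = 1 := Real.sin_sq_add_cos_sq _

theorem cn_sq (u q : ℝ) : cn u q ^ 2 = 1 - sn u q ^ 2 := by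
  linarith [sn_sq_add_cn_sq u q]

theorem dn_sq (hq0 : 0 ≤ q) (hq1 : q < 1) (u : ℝ) : dn u q ^ 2 = 1 - q ^ 2 * sn u q ^ 2 :=
  Real.sq_sqrt (one_sub_sq_mul_sin_sq_pos hq0 hq1 _).le

theorem dn_pos (hq0 : 0 ≤ q) (hq1 : q < 1) (u : ℝ) : 0 < dn u q :=
  Real.sqrt_pos.2 (one_sub_sq_mul_sin_sq_pos hq0 hq1 _)

theorem hasDerivAt_sn (hq0 : 0 ≤ q) (hq1 : q < 1) (u : ℝ) :
    HasDerivAt (fun u => sn u q) (cn u q * dn u q) u :=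
  (hasDerivAt_am hq0 hq1 u).sin

theorem hasDerivAt_cn (hq0 : 0 ≤ q) (hq1 : q < 1) (u : ℝ) :
    HasDerivAt (fun u => cn u q) (-(sn u q * dn u q)) u := by
  exact (hasDerivAt_am hq0 hq1 u).cos.congr_deriv (neg_mul _ _)

theorem hasDerivAt_dn (hq0 : 0 ≤ q) (hq1 : q < 1) (u : ℝ) :
    HasDerivAt (fun u => dn u q) (-(q ^ 2 * sn u q * cn u q)) u := by
  have h := ((((hasDerivAt_sn hq0 hq1 u).pow 2).const_mul (q ^ 2)).const_sub 1).sqrt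
    (one_sub_sq_mul_sin_sq_pos hq0 hq1 _).ne'
  refine h.congr_deriv ?_
  have hd := (dn_pos hq0 hq1 u).ne'
  change _ / (2 * dn u q) = _
  field_simp
  norm_num
  ring

theorem continuous_dn (hq0 : 0 ≤ q) (hq1 : q < 1) : Continuous fun u => dn u q :=
  continuous_iff_continuousAt.2 fun u => (hasDerivAt_dn hq0 hq1 u).continuousAt

theorem hasDerivAt_jacobiEpsilon (hq0 : 0 ≤ q) (hq1 : q < 1) (u : ℝ) :
    HasDerivAt (fun u => jacobiEpsilon u q) (dn u q ^ 2) u := by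
  have hc : Continuous fun u => dn u q ^ 2 := (continuous_dn hq0 hq1).pow 2
  exact intervalIntegral.integral_hasDerivAt_right (hc.intervalIntegrable _ _)
    (hc.stronglyMeasurableAtFilter _ _) hc.continuousAt

/-- The derivative of `u₁`. -/
noncomputable def u₁' (q t : ℝ) : ℝ :=
  1 - 2 * (1 + q ^ 2) * sn t q ^ 2 + 3 * q ^ 2 * sn t q ^ 4

/-- The derivative of `u₂`. -/
noncomputable def u₂' (q t : ℝ) : ℝ :=
  (-2 * ((-2 * q ^ 6 + 3 * q ^ 4 - 5 * q ^ 2 + 2)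
      + 4 * q ^ 2 * (q ^ 4 - q ^ 2 + 1) * cn t q ^ 2)
    + ((-q ^ 4 + 3 * q ^ 2 - 2) + 2 * (q ^ 4 - q ^ 2 + 1) * dn t q ^ 2)) * u₁ q t
  + ((-q ^ 4 + 3 * q ^ 2 - 2) * t + 2 * (q ^ 4 - q ^ 2 + 1) * jacobiEpsilon t q) * u₁' q t

theorem hasDerivAt_u₁ (hq0 : 0 ≤ q) (hq1 : q < 1) (t : ℝ) :
    HasDerivAt (u₁ q) (u₁' q t) t := by
  refine (((hasDerivAt_sn hq0 hq1 t).mul (hasDerivAt_cn hq0 hq1 t)).mul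
    (hasDerivAt_dn hq0 hq1 t)).congr_deriv ?_
  have hc := cn_sq t q
  have hd := dn_sq hq0 hq1 t
  simp only [u₁', Pi.mul_apply]
  linear_combination (dn t q ^ 2 - q ^ 2 * sn t q ^ 2) * hc + (1 - 2 * sn t q ^ 2) * hd

/-- Lamé's equation for `u₁`, which is half the derivative of `sn ^ 2`: it reflects that the
velocity of the orbit solves the linearized equation. -/
theorem hasDerivAt_u₁' (hq0 : 0 ≤ q) (hq1 : q < 1) (t : ℝ) :
    HasDerivAt (u₁' q) ((12 * q ^ 2 * sn t q ^ 2 - 4 - 4 * q ^ 2) * u₁ q t) t := by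
  have h := hasDerivAt_sn hq0 hq1 t
  refine ((((h.pow 2).const_mul (2 * (1 + q ^ 2))).const_sub 1).add
    ((h.pow 4).const_mul (3 * q ^ 2))).congr_deriv ?_
  simp only [u₁]
  push_cast
  ring

theorem hasDerivAt_u₂ (hq0 : 0 ≤ q) (hq1 : q < 1) (t : ℝ) :
    HasDerivAt (u₂ q) (u₂' q t) t := by
  have hc := hasDerivAt_cn hq0 hq1 t
  refine (((((hc.pow 2).const_mul (-2 * q ^ 6 + 3 * q ^ 4 - 5 * q ^ 2 + 2)).const_add
    (-1 + q ^ 2)).add ((hc.pow 4).const_mul (2 * q ^ 2 * (q ^ 4 - q ^ 2 + 1)))).add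
    ((((hasDerivAt_id t).const_mul (-q ^ 4 + 3 * q ^ 2 - 2)).add
      ((hasDerivAt_jacobiEpsilon hq0 hq1 t).const_mul (2 * (q ^ 4 - q ^ 2 + 1)))).mul
      (hasDerivAt_u₁ hq0 hq1 t))).congr_deriv ?_
  simp only [u₂', u₁, Pi.add_apply, id]
  push_cast
  ring

/-- The terms carrying `t` and `jacobiEpsilon` match because `u₁` solves the same equation. What
remains is a polynomial identity in `sn ^ 2`. -/
theorem hasDerivAt_u₂' (hq0 : 0 ≤ q) (hq1 : q < 1) (t : ℝ) :
    HasDerivAt (u₂' q) ((12 * q ^ 2 * sn t q ^ 2 - 4 - 4 * q ^ 2) * u₂ q t) t := by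
  have hc := hasDerivAt_cn hq0 hq1 t
  have hd := hasDerivAt_dn hq0 hq1 t
  have h1 := ((((hc.pow 2).const_mul (4 * q ^ 2 * (q ^ 4 - q ^ 2 + 1))).const_add
    (-2 * q ^ 6 + 3 * q ^ 4 - 5 * q ^ 2 + 2)).const_mul (-2)).add
    (((hd.pow 2).const_mul (2 * (q ^ 4 - q ^ 2 + 1))).const_add (-q ^ 4 + 3 * q ^ 2 - 2))
  have h2 := ((hasDerivAt_id t).const_mul (-q ^ 4 + 3 * q ^ 2 - 2)).add
      ((hasDerivAt_jacobiEpsilon hq0 hq1 t).const_mul (2 * (q ^ 4 - q ^ 2 + 1)))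
  refine ((h1.mul (hasDerivAt_u₁ hq0 hq1 t)).add
    (h2.mul (hasDerivAt_u₁' hq0 hq1 t))).congr_deriv ?_
  have ec := cn_sq t q
  have ed := dn_sq hq0 hq1 t
  have ec4 : cn t q ^ 4 = (1 - sn t q ^ 2) ^ 2 := by rw [← ec]; ring
  -- The only products left are multiples of `u₁ ^ 2`. Since `cn ^ 2` and `dn ^ 2` have derivatives
  -- `-2 u₁` and `-2 q² u₁`, the coefficient is `(16 - 4) q² (q⁴ - q² + 1)`, used at the end.
  have hu : ∀ A : ℝ, A * (sn t q * cn t q * dn t q) * (sn t q * cn t q * dn t q)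
      = A * sn t q ^ 2 * (1 - sn t q ^ 2) * (1 - q ^ 2 * sn t q ^ 2) := by
    intro A; rw [← ec, ← ed]; ring
  simp only [u₂, u₁, u₁', Pi.add_apply, Pi.pow_apply, id]
  push_cast
  rw [ec4, ec, ed]
  generalize jacobiEpsilon t q = E
  linear_combination hu (12 * q ^ 2 * (q ^ 4 - q ^ 2 + 1))

end Jacobi

/-! ### The unperturbed orbit in closed form -/

section Unperturbed

variable {a c y η : ℝ}

theorem modulus_sq (hcb : c < -a - c) (hba : -a - c < a) :
    modulus a c ^ 2 = (2 * c + a) / (c - a) :=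
  Real.sq_sqrt (div_nonneg_of_nonpos (by linarith) (by linarith))

theorem modulus_nonneg (a c : ℝ) : 0 ≤ modulus a c := Real.sqrt_nonneg _

theorem modulus_lt_one (hcb : c < -a - c) (hba : -a - c < a) : modulus a c < 1 := by
  rw [modulus, ← Real.sqrt_one]
  refine Real.sqrt_lt_sqrt (div_nonneg_of_nonpos (by linarith) (by linarith)) ?_
  rw [div_lt_one_of_neg (by linarith)]
  linarith

/-- The closed form `c - (2c + a) sn²(√((a - c)/6) t + θ)` of the unperturbed solution. -/
noncomputable def snSolution (a c y η t : ℝ) : ℝ :=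
  c - (2 * c + a) * sn (Real.sqrt ((a - c) / 6) * t + phase a c y η) (modulus a c) ^ 2

/-- The velocity of `snSolution`. -/
noncomputable def snVelocity (a c y η t : ℝ) : ℝ :=
  -2 * (2 * c + a) * Real.sqrt ((a - c) / 6) *
    u₁ (modulus a c) (Real.sqrt ((a - c) / 6) * t + phase a c y η)

theorem hasDerivAt_comp_mul_add {f : ℝ → ℝ} {f' r θ t : ℝ} (h : HasDerivAt f f' (r * t + θ)) :
    HasDerivAt (fun t => f (r * t + θ)) (r * f') t := by
  have h1 : HasDerivAt (fun t : ℝ => r * t + θ) r t := by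
    simpa using ((hasDerivAt_id t).const_mul r).add_const θ
  exact (h.comp t h1).congr_deriv (mul_comm _ _)

theorem hasDerivAt_snSolution (hcb : c < -a - c) (hba : -a - c < a) (t : ℝ) :
    HasDerivAt (snSolution a c y η) (snVelocity a c y η t) t := by
  have h := hasDerivAt_comp_mul_add (hasDerivAt_sn (modulus_nonneg a c) (modulus_lt_one hcb hba)
    (Real.sqrt ((a - c) / 6) * t + phase a c y η))
  refine (((h.pow 2).const_mul (2 * c + a)).const_sub c).congr_deriv ?_
  simp only [snVelocity, u₁]
  push_cast
  ring

/-- In the scaled variable, Lamé's potential is `2 x₀`. -/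
theorem sq_mul_lame_potential (hcb : c < -a - c) (hba : -a - c < a) (t : ℝ) :
    Real.sqrt ((a - c) / 6) ^ 2 * (12 * modulus a c ^ 2 *
      sn (Real.sqrt ((a - c) / 6) * t + phase a c y η) (modulus a c) ^ 2 - 4 -
        4 * modulus a c ^ 2) = 2 * snSolution a c y η t := by
  rw [snSolution, modulus_sq hcb hba, Real.sq_sqrt (by linarith)]
  have h : c - a ≠ 0 := by linarith
  field_simp
  ring

theorem hasDerivAt_snVelocity (hcb : c < -a - c) (hba : -a - c < a) (t : ℝ) :
    HasDerivAt (snVelocity a c y η) (snSolution a c y η t ^ 2 - calB a c) t := by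
  have h := hasDerivAt_comp_mul_add (hasDerivAt_u₁ (modulus_nonneg a c) (modulus_lt_one hcb hba)
    (Real.sqrt ((a - c) / 6) * t + phase a c y η))
  refine (h.const_mul (-2 * (2 * c + a) * Real.sqrt ((a - c) / 6))).congr_deriv ?_
  have hr : Real.sqrt ((a - c) / 6) ^ 2 = (a - c) / 6 := Real.sq_sqrt (by linarith)
  have hca : c - a ≠ 0 := by linarith
  simp only [snSolution, u₁', calB]
  generalize sn (Real.sqrt ((a - c) / 6) * t + phase a c y η) (modulus a c) = S
  rw [modulus_sq hcb hba]
  generalize Real.sqrt ((a - c) / 6) = r at hr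
  field_simp
  linear_combination (-6 * (2 * c + a) * ((c - a) * (1 - 2 * S ^ 2) +
    (2 * c + a) * S ^ 2 * (3 * S ^ 2 - 2))) * hr

/-- Derivative of `w₁`. -/
theorem hasDerivAt_w₁ (hcb : c < -a - c) (hba : -a - c < a) (k t : ℝ) :
    HasDerivAt (w₁ a c y η k) (k * (Real.sqrt ((a - c) / 6) *
      u₁' (modulus a c) (Real.sqrt ((a - c) / 6) * t + phase a c y η))) t :=
  (hasDerivAt_comp_mul_add (hasDerivAt_u₁ (modulus_nonneg a c) (modulus_lt_one hcb hba) _)).const_mul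
    k

theorem hasDerivAt_w₂ (hcb : c < -a - c) (hba : -a - c < a) (k t : ℝ) :
    HasDerivAt (w₂ a c y η k) (k * (Real.sqrt ((a - c) / 6) *
      u₂' (modulus a c) (Real.sqrt ((a - c) / 6) * t + phase a c y η))) t :=
  (hasDerivAt_comp_mul_add (hasDerivAt_u₂ (modulus_nonneg a c) (modulus_lt_one hcb hba) _)).const_mul
    k

theorem hasDerivAt_deriv_w₁ (hcb : c < -a - c) (hba : -a - c < a) (k t : ℝ) :
    HasDerivAt (deriv (w₁ a c y η k)) (2 * snSolution a c y η t * w₁ a c y η k t) t := by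
  have h := ((hasDerivAt_comp_mul_add (hasDerivAt_u₁' (modulus_nonneg a c)
    (modulus_lt_one hcb hba)
    (Real.sqrt ((a - c) / 6) * t + phase a c y η))).const_mul (Real.sqrt ((a - c) / 6))).const_mul k
  rw [funext fun s => (hasDerivAt_w₁ (y := y) (η := η) hcb hba k s).deriv]
  refine h.congr_deriv ?_
  rw [← sq_mul_lame_potential hcb hba, w₁]
  ring

theorem hasDerivAt_deriv_w₂ (hcb : c < -a - c) (hba : -a - c < a) (k t : ℝ) :
    HasDerivAt (deriv (w₂ a c y η k)) (2 * snSolution a c y η t * w₂ a c y η k t) t := by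
  have h := ((hasDerivAt_comp_mul_add (hasDerivAt_u₂' (modulus_nonneg a c)
    (modulus_lt_one hcb hba)
    (Real.sqrt ((a - c) / 6) * t + phase a c y η))).const_mul (Real.sqrt ((a - c) / 6))).const_mul k
  rw [funext fun s => (hasDerivAt_w₂ (y := y) (η := η) hcb hba k s).deriv]
  refine h.congr_deriv ?_
  rw [← sq_mul_lame_potential hcb hba, w₂]
  ring

theorem am_phase (hcb : c < -a - c) (hba : -a - c < a) : am (phase a c y η) (modulus a c) =
    if η < 0 then -Real.arcsin (Real.sqrt ((c - y) / (2 * c + a)))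
      else Real.arcsin (Real.sqrt ((c - y) / (2 * c + a))) := by
  rw [phase]
  split_ifs
  · rw [← ellipticF_neg, am_ellipticF (modulus_nonneg a c) (modulus_lt_one hcb hba)]
  · rw [am_ellipticF (modulus_nonneg a c) (modulus_lt_one hcb hba)]

theorem sn_phase_sq (hcb : c < -a - c) (hba : -a - c < a) (hy : y ∈ Icc c (-a - c)) :
    sn (phase a c y η) (modulus a c) ^ 2 = (c - y) / (2 * c + a) := by
  have h0 : 0 ≤ (c - y) / (2 * c + a) :=
    div_nonneg_of_nonpos (by linarith [hy.1]) (by linarith)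
  have h1 : (c - y) / (2 * c + a) ≤ 1 := by
    rw [div_le_one_of_neg (by linarith)]
    linarith [hy.2]
  have h2 : Real.sin (Real.arcsin (Real.sqrt ((c - y) / (2 * c + a)))) ^ 2 =
      (c - y) / (2 * c + a) := by
    rw [Real.sin_arcsin (by linarith [Real.sqrt_nonneg ((c - y) / (2 * c + a))])
      (Real.sqrt_le_one.2 h1), Real.sq_sqrt h0]
  rw [sn, am_phase hcb hba]
  split_ifs
  · rw [Real.sin_neg, neg_sq, h2]
  · exact h2

theorem snSolution_zero (hcb : c < -a - c) (hba : -a - c < a) (hy : y ∈ Icc c (-a - c)) :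
    snSolution a c y η 0 = y := by
  rw [snSolution, mul_zero, zero_add, sn_phase_sq hcb hba hy]
  have h : 2 * c + a ≠ 0 := by linarith
  rw [mul_div_cancel₀ _ h, sub_sub_cancel]

/-- The energy fixes the square of the velocity, `(2/3) (y - a) (y - c) (y + a + c)`; the sign built
into the phase fixes its root. -/
theorem snVelocity_zero (hcb : c < -a - c) (hba : -a - c < a) (hy : y ∈ Icc c (-a - c))
    (hη : hamiltonian (calB a c) y η = a * c * (a + c) / 3) :
    snVelocity a c y η 0 = η := by
  have hq0 := modulus_nonneg a c
  have hq1 := modulus_lt_one hcb hba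
  have hca : c - a ≠ 0 := by linarith
  have hca' : 2 * c + a ≠ 0 := by linarith
  have hsq : snVelocity a c y η 0 ^ 2 = η ^ 2 := by
    have hr : Real.sqrt ((a - c) / 6) ^ 2 = (a - c) / 6 := Real.sq_sqrt (by linarith)
    have hu : u₁ (modulus a c) (phase a c y η) ^ 2 = (c - y) / (2 * c + a) *
        (1 - (c - y) / (2 * c + a)) * (1 - (2 * c + a) / (c - a) * ((c - y) / (2 * c + a))) := by
      rw [u₁, mul_pow, mul_pow, cn_sq, dn_sq hq0 hq1, sn_phase_sq hcb hba hy, modulus_sq hcb hba]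
    have hη' : η ^ 2 = 2 * (a * c * (a + c) / 3 + y ^ 3 / 3 - calB a c * y) := by
      rw [hamiltonian] at hη
      linarith
    rw [snVelocity, mul_zero, zero_add, mul_pow, mul_pow, hr, hu, hη', calB]
    field_simp
    ring
  have hs : 0 ≤ Real.sin (Real.arcsin (Real.sqrt ((c - y) / (2 * c + a)))) :=
    Real.sin_nonneg_of_nonneg_of_le_pi (Real.arcsin_nonneg.2 (Real.sqrt_nonneg _))
      ((Real.arcsin_le_pi_div_two _).trans (by linarith [Real.pi_pos]))
  have hc : 0 ≤ Real.cos (Real.arcsin (Real.sqrt ((c - y) / (2 * c + a)))) :=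
    Real.cos_arcsin_nonneg _
  have hd := dn_pos hq0 hq1 (phase a c y η)
  -- As `2 * c + a < 0`, the velocity has the sign of `u₁` at the phase, hence of `sn` there.
  have hk : 0 ≤ -2 * (2 * c + a) * Real.sqrt ((a - c) / 6) :=
    mul_nonneg (by linarith) (Real.sqrt_nonneg _)
  rcases lt_or_ge η 0 with h | h
  · have h1 : snVelocity a c y η 0 ≤ 0 := by
      rw [snVelocity, mul_zero, zero_add, u₁, sn, cn, am_phase hcb hba, if_pos h, Real.sin_neg,
        Real.cos_neg]
      refine mul_nonpos_of_nonneg_of_nonpos hk (mul_nonpos_of_nonpos_of_nonneg ?_ hd.le)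
      exact mul_nonpos_of_nonpos_of_nonneg (neg_nonpos.2 hs) hc
    nlinarith
  · have h1 : 0 ≤ snVelocity a c y η 0 := by
      rw [snVelocity, mul_zero, zero_add, u₁, sn, cn, am_phase hcb hba, if_neg h.not_gt]
      exact mul_nonneg hk (mul_nonneg (mul_nonneg hs hc) hd.le)
    exact (pow_left_inj₀ h1 h two_ne_zero).1 hsq

/-- The quadratic field is not globally Lipschitz, but the difference of two solutions satisfies the
linear equation `d'' = (x + z) d`, whose coefficient is bounded on `[0, T]`. Uniqueness is applied
to `d` against the zero solution. -/
theorem IsUnperturbedSolution.eqOn {b : ℝ} {x z : ℝ → ℝ} (hx : IsUnperturbedSolution b y η x)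
    (hz : IsUnperturbedSolution b y η z) : EqOn x z (Ici 0) := by
  obtain ⟨ξ, hx0, hξ0, hx', hξ'⟩ := hx
  obtain ⟨ζ, hz0, hζ0, hz', hζ'⟩ := hz
  intro T hT
  have hcx : ContinuousOn x (Icc 0 T) := fun t ht =>
    (hx' t ht.1).continuousWithinAt.mono Icc_subset_Ici_self
  have hcz : ContinuousOn z (Icc 0 T) := fun t ht =>
    (hz' t ht.1).continuousWithinAt.mono Icc_subset_Ici_self
  have hcξ : ContinuousOn ξ (Icc 0 T) := fun t ht =>
    (hξ' t ht.1).continuousWithinAt.mono Icc_subset_Ici_self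
  have hcζ : ContinuousOn ζ (Icc 0 T) := fun t ht =>
    (hζ' t ht.1).continuousWithinAt.mono Icc_subset_Ici_self
  obtain ⟨M, hM⟩ := isCompact_Icc.exists_bound_of_continuousOn (hcx.add hcz)
  have hM0 : 0 ≤ M := (norm_nonneg _).trans (hM 0 ⟨le_rfl, hT⟩)
  have key := ODE_solution_unique_of_mem_Icc_right (a := 0) (b := T) (s := fun _ => univ)
    (K := (⟨M, hM0⟩ : ℝ≥0) ⊔ 1)
    (v := fun t p => ((p.2, (x t + z t) * p.1) : ℝ × ℝ))
    (f := fun t => (x t - z t, ξ t - ζ t)) (g := fun _ => (0, 0)) ?_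
    ((hcx.sub hcz).prodMk (hcξ.sub hcζ)) ?_ (fun _ _ => mem_univ _) continuousOn_const ?_
    (fun _ _ => mem_univ _) (by simp [hx0, hz0, hξ0, hζ0])
  · have := congrArg Prod.fst (key ⟨hT, le_rfl⟩)
    exact sub_eq_zero.1 this
  · intro t ht
    refine LipschitzOnWith.of_dist_le_mul fun p _ p' _ => ?_
    have hMt := hM t (Ico_subset_Icc_self ht)
    simp only [Pi.add_apply] at hMt
    rw [Prod.dist_eq, Prod.dist_eq]
    have h1 : dist p.1 p'.1 ≤ max (dist p.1 p'.1) (dist p.2 p'.2) := le_max_left _ _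
    have h2 : dist p.2 p'.2 ≤ max (dist p.1 p'.1) (dist p.2 p'.2) := le_max_right _ _
    have hK1 : (1 : ℝ) ≤ (((⟨M, hM0⟩ : ℝ≥0) ⊔ 1 : ℝ≥0) : ℝ) := by
      exact_mod_cast (le_sup_right : (1 : ℝ≥0) ≤ _ ⊔ 1)
    have hK2 : M ≤ (((⟨M, hM0⟩ : ℝ≥0) ⊔ 1 : ℝ≥0) : ℝ) := by
      exact_mod_cast (le_sup_left : (⟨M, hM0⟩ : ℝ≥0) ≤ _)
    refine max_le ?_ ?_
    · exact h2.trans (le_mul_of_one_le_left (dist_nonneg.trans h2) hK1)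
    · simp only [Real.dist_eq, ← mul_sub, abs_mul] at h1 ⊢
      exact mul_le_mul (hMt.trans hK2) h1 (abs_nonneg _) (hM0.trans hK2)
  · intro t ht
    have hsub : Ici t ⊆ Ici 0 := Ici_subset_Ici.2 ht.1
    refine HasDerivWithinAt.prodMk (((hx' t ht.1).sub (hz' t ht.1)).mono hsub) ?_
    exact (((hξ' t ht.1).sub (hζ' t ht.1)).mono hsub).congr_deriv (by ring)
  · intro t _
    exact (hasDerivWithinAt_const t (Ici t) ((0, 0) : ℝ × ℝ)).congr_deriv (by simp; rfl)

theorem isUnperturbedSolution_snSolution (hcb : c < -a - c) (hba : -a - c < a)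
    (hy : y ∈ Icc c (-a - c)) (hη : hamiltonian (calB a c) y η = a * c * (a + c) / 3) :
    IsUnperturbedSolution (calB a c) y η (snSolution a c y η) :=
  ⟨snVelocity a c y η, snSolution_zero hcb hba hy, snVelocity_zero hcb hba hy hη,
    fun t _ => (hasDerivAt_snSolution hcb hba t).hasDerivWithinAt,
    fun t _ => (hasDerivAt_snVelocity hcb hba t).hasDerivWithinAt⟩

end Unperturbed

/-! ### Pathwise variation of constants and the recursive bound -/

section Pathwise

variable {X x₀ F x ξ f w v₁ v₂ : ℝ → ℝ} {t : ℝ}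

/-- Freezing a path at its value at 0 for negative times makes it continuous on `ℝ`, so its
primitives have two-sided derivatives; integrals over `[0, t]` do not change. -/
theorem continuous_comp_max_zero {g : ℝ → ℝ} (hg : ContinuousOn g (Ici 0)) :
    Continuous fun s => g (max s 0) :=
  hg.comp_continuous (by fun_prop) fun s => le_max_right s 0

theorem integral_comp_max_zero (g : ℝ → ℝ) (ht : 0 ≤ t) :
    ∫ s in (0 : ℝ)..t, g (max s 0) = ∫ s in (0 : ℝ)..t, g s := by
  refine intervalIntegral.integral_congr fun s hs => ?_
  rw [uIcc_of_le ht] at hs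
  simp only [max_eq_left hs.1]

/-- The pathwise integral `∫₀ᵗ w dF`, defined through integration by parts. -/
noncomputable def pathIntegral (w F : ℝ → ℝ) (t : ℝ) : ℝ :=
  w t * F t - ∫ s in (0 : ℝ)..t, deriv w s * F s

theorem continuous_primitive {g : ℝ → ℝ} (hg : Continuous g) :
    Continuous fun t => ∫ s in (0 : ℝ)..t, g s :=
  intervalIntegral.continuous_primitive (fun _ _ => hg.intervalIntegrable _ _) 0

theorem hasDerivAt_primitive {g : ℝ → ℝ} (hg : Continuous g) (t : ℝ) :
    HasDerivAt (fun t => ∫ s in (0 : ℝ)..t, g s) (g t) t :=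
  intervalIntegral.integral_hasDerivAt_right (hg.intervalIntegrable _ _)
    (hg.stronglyMeasurableAtFilter _ _) hg.continuousAt

theorem continuousOn_primitive {g : ℝ → ℝ} (hg : ContinuousOn g (Ici 0)) :
    ContinuousOn (fun t => ∫ s in (0 : ℝ)..t, g s) (Ici 0) :=
  (continuous_primitive (continuous_comp_max_zero hg)).continuousOn.congr fun _ ht =>
    (integral_comp_max_zero g ht).symm

theorem SolvesLinearized.continuousOn (h : SolvesLinearized x₀ F x) :
    ContinuousOn x (Ici 0) := by
  obtain ⟨ξ, hξ, hx, -⟩ := h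
  exact (continuousOn_primitive hξ).congr fun t ht => hx t ht

theorem eq_of_hasDerivAt_zero {G G' : ℝ → ℝ} (hG : ∀ t, HasDerivAt G (G' t) t)
    (hG' : ∀ t, 0 ≤ t → G' t = 0) (ht : 0 ≤ t) : G t = G 0 :=
  constant_of_has_deriv_right_zero (fun s _ => (hG s).continuousAt.continuousWithinAt)
    (fun s hs => hG' s hs.1 ▸ (hG s).hasDerivWithinAt) t ⟨ht, le_rfl⟩

/-- The Wronskian of a solution of the homogeneous equation and a solution of the linearized
equation driven by `F` is the integral of the former against `F`. -/
theorem wronskian_eq_pathIntegral (hX : Continuous X) (hx₀ : EqOn x₀ X (Ici 0))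
    (hF : ContinuousOn F (Ici 0)) (hw : Differentiable ℝ w)
    (hw' : ∀ t, HasDerivAt (deriv w) (2 * X t * w t) t) (hξ : ContinuousOn ξ (Ici 0))
    (hx : ∀ t, 0 ≤ t → x t = ∫ s in (0 : ℝ)..t, ξ s)
    (hξ' : ∀ t, 0 ≤ t → ξ t = (∫ s in (0 : ℝ)..t, 2 * x₀ s * x s) + F t) (ht : 0 ≤ t) :
    w t * ξ t - deriv w t * x t = pathIntegral w F t := by
  have hξc := continuous_comp_max_zero hξ
  have hFc := continuous_comp_max_zero hF
  set z : ℝ → ℝ := fun t => ∫ s in (0 : ℝ)..t, ξ (max s 0) with hz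
  have hzx : ∀ t, 0 ≤ t → z t = x t := fun t ht => by
    rw [hz, hx t ht]
    exact integral_comp_max_zero ξ ht
  have hzc : Continuous z := continuous_primitive hξc
  have hwc : Continuous (deriv w) := continuous_iff_continuousAt.2 fun t => (hw' t).continuousAt
  -- The velocity `ξ` is as rough as `F`, but `ζ = ξ - F` is differentiable.
  set ζ : ℝ → ℝ := fun t => ∫ s in (0 : ℝ)..t, 2 * X s * z s with hζ
  have hζξ : ∀ t, 0 ≤ t → ζ t = ξ t - F t := fun t ht => by
    rw [hξ' t ht, add_sub_cancel_right]
    refine intervalIntegral.integral_congr fun s hs => ?_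
    rw [uIcc_of_le ht] at hs
    simp only [hzx s hs.1, hx₀ (mem_Ici.2 hs.1)]
  -- For `t ≥ 0` the derivative is `w' (ζ + F - ξ) = 0`: the two terms in `2 X w z` cancel.
  have key := eq_of_hasDerivAt_zero
    (G := fun t => w t * ζ t - deriv w t * z t + ∫ s in (0 : ℝ)..t, deriv w s * F (max s 0))
    (fun t => (((hw t).hasDerivAt.mul (hasDerivAt_primitive (by fun_prop) t)).sub
      ((hw' t).mul (hasDerivAt_primitive hξc t))).add
        (hasDerivAt_primitive (hwc.mul hFc) t)) (fun t ht => ?_) ht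
  · have h0 : (∫ s in (0 : ℝ)..t, deriv w s * F (max s 0)) =
        ∫ s in (0 : ℝ)..t, deriv w s * F s :=
      intervalIntegral.integral_congr fun s hs => by
        rw [uIcc_of_le ht] at hs
        simp only [max_eq_left hs.1]
    simp only [hζξ t ht, hzx t ht, h0] at key
    have hz0 : z 0 = 0 := intervalIntegral.integral_same
    have hζ0 : ζ 0 = 0 := intervalIntegral.integral_same
    rw [hz0, hζ0, intervalIntegral.integral_same] at key
    rw [pathIntegral]
    linarith
  · have h1 := hζξ t ht
    have h2 : (∫ s in (0 : ℝ)..t, ξ (max s 0)) = z t := rfl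
    have h3 : (∫ s in (0 : ℝ)..t, 2 * X s * z s) = ζ t := rfl
    simp only [h2, h3, Pi.mul_apply, max_eq_left ht, h1]
    ring

/-- Variation of constants. -/
theorem SolvesLinearized.eq_pathIntegral (hX : Continuous X) (hx₀ : EqOn x₀ X (Ici 0))
    (hF : ContinuousOn F (Ici 0)) (hv₁ : Differentiable ℝ v₁) (hv₂ : Differentiable ℝ v₂)
    (hv₁' : ∀ t, HasDerivAt (deriv v₁) (2 * X t * v₁ t) t)
    (hv₂' : ∀ t, HasDerivAt (deriv v₂) (2 * X t * v₂ t) t)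
    (hW : ∀ t, 0 ≤ t → v₁ t * deriv v₂ t - deriv v₁ t * v₂ t = 1)
    (h : SolvesLinearized x₀ F x) (ht : 0 ≤ t) :
    x t = v₂ t * pathIntegral v₁ F t - v₁ t * pathIntegral v₂ F t := by
  obtain ⟨ξ, hξ, hx, hξ'⟩ := h
  rw [← wronskian_eq_pathIntegral hX hx₀ hF hv₁ hv₁' hξ hx hξ' ht,
    ← wronskian_eq_pathIntegral hX hx₀ hF hv₂ hv₂' hξ hx hξ' ht]
  -- Eliminating `ξ` between the two Wronskian identities leaves `x` times the Wronskian of `v₁` and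
  -- `v₂`.
  linear_combination (-x t) * hW t ht

/-- For a driver with a density, as for all coefficients with `n ≥ 2`, the integration by parts can
be undone. -/
theorem pathIntegral_primitive (hw : Differentiable ℝ w) (hw' : Continuous (deriv w))
    (hf : ContinuousOn f (Ici 0)) (ht : 0 ≤ t) :
    pathIntegral w (fun t => ∫ s in (0 : ℝ)..t, f s) t = ∫ s in (0 : ℝ)..t, w s * f s := by
  have hfc := continuous_comp_max_zero hf
  have h := intervalIntegral.integral_mul_deriv_eq_deriv_mul (a := 0) (b := t)
    (u := w) (v := fun t => ∫ s in (0 : ℝ)..t, f (max s 0))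
    (fun s _ => (hw s).hasDerivAt) (fun s _ => hasDerivAt_primitive hfc s)
    (hw'.intervalIntegrable _ _) (hfc.intervalIntegrable _ _)
  have h1 : (∫ s in (0 : ℝ)..t, w s * f (max s 0)) = ∫ s in (0 : ℝ)..t, w s * f s :=
    intervalIntegral.integral_congr fun s hs => by
      rw [uIcc_of_le ht] at hs
      simp only [max_eq_left hs.1]
  have h2 : (∫ s in (0 : ℝ)..t, deriv w s * ∫ r in (0 : ℝ)..s, f (max r 0)) =
      ∫ s in (0 : ℝ)..t, deriv w s * ∫ r in (0 : ℝ)..s, f r :=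
    intervalIntegral.integral_congr fun s hs => by
      rw [uIcc_of_le ht] at hs
      simp only [integral_comp_max_zero f hs.1]
  rw [h1, h2, intervalIntegral.integral_same, mul_zero, sub_zero, integral_comp_max_zero f ht] at h
  exact h.symm

theorem SolvesLinearized.eq_integral_kernel (hX : Continuous X) (hx₀ : EqOn x₀ X (Ici 0))
    (hf : ContinuousOn f (Ici 0)) (hv₁ : Differentiable ℝ v₁) (hv₂ : Differentiable ℝ v₂)
    (hv₁' : ∀ t, HasDerivAt (deriv v₁) (2 * X t * v₁ t) t)
    (hv₂' : ∀ t, HasDerivAt (deriv v₂) (2 * X t * v₂ t) t)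
    (hW : ∀ t, 0 ≤ t → v₁ t * deriv v₂ t - deriv v₁ t * v₂ t = 1)
    (h : SolvesLinearized x₀ (fun t => ∫ s in (0 : ℝ)..t, f s) x) (ht : 0 ≤ t) :
    x t = ∫ s in (0 : ℝ)..t, kernel v₁ v₂ t s * f s := by
  have hc₁ : Continuous (deriv v₁) := continuous_iff_continuousAt.2 fun t => (hv₁' t).continuousAt
  have hc₂ : Continuous (deriv v₂) := continuous_iff_continuousAt.2 fun t => (hv₂' t).continuousAt
  have hi : ∀ {v : ℝ → ℝ}, Differentiable ℝ v →
      IntervalIntegrable (fun s => v s * f s) volume 0 t := fun hv =>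
    (hv.continuous.continuousOn.mul
      (hf.mono (by rw [uIcc_of_le ht]; exact Icc_subset_Ici_self))).intervalIntegrable
  rw [h.eq_pathIntegral hX hx₀ (continuousOn_primitive hf) hv₁ hv₂ hv₁' hv₂' hW ht,
    pathIntegral_primitive hv₁ hc₁ hf ht, pathIntegral_primitive hv₂ hc₂ hf ht,
    ← intervalIntegral.integral_const_mul, ← intervalIntegral.integral_const_mul,
    ← intervalIntegral.integral_sub ((hi hv₁).const_mul _) ((hi hv₂).const_mul _)]
  refine intervalIntegral.integral_congr fun s _ => ?_
  simp only [kernel]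
  ring

theorem continuous_gammaSeq (h₁ : Continuous v₁) (h₂ : Continuous v₂) {n : ℕ} (hn : 1 ≤ n) :
    Continuous (gammaSeq v₁ v₂ n) := by
  induction n using Nat.strong_induction_on with
  | _ n ih =>
    rcases hn.eq_or_lt with rfl | hn
    · have : gammaSeq v₁ v₂ 1 = fun t => |v₁ t| + |v₂ t| := by funext t; rw [gammaSeq]
      rw [this]
      exact h₁.abs.add h₂.abs
    · rw [funext fun t => gammaSeq_of_two_le v₁ v₂ n hn t]
      have hs : Continuous fun s => ∑ j ∈ Finset.Ico 1 n,
          gammaSeq v₁ v₂ j s * gammaSeq v₁ v₂ (n - j) s := by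
        refine continuous_finsetSum _ fun j hj => ?_
        rw [Finset.mem_Ico] at hj
        exact (ih j hj.2 hj.1).mul (ih (n - j) (by omega) (by omega))
      refine intervalIntegral.continuous_parametric_intervalIntegral_of_continuous
        (s := fun t => t) ?_ continuous_id
      simp only [kernel]
      refine Continuous.mul ?_ (hs.comp continuous_snd)
      exact (((h₂.comp continuous_fst).mul (h₁.comp continuous_snd)).sub
        ((h₁.comp continuous_fst).mul (h₂.comp continuous_snd))).abs

/-- The bound on the first coefficient propagates to all coefficients. -/
theorem abs_le_gammaSeq_div {z : ℕ → ℝ → ℝ} (h₁ : Continuous v₁) (h₂ : Continuous v₂)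
    (hz : ∀ n, 1 ≤ n → ContinuousOn (z n) (Ici 0))
    (hrec : ∀ n, 2 ≤ n → ∀ t, 0 ≤ t → z n t = ∫ s in (0 : ℝ)..t, kernel v₁ v₂ t s *
      ∑ j ∈ Finset.Ico 1 n, z j s * z (n - j) s) {T σ : ℝ}
    (hone : ∀ t ∈ Icc 0 T, |z 1 t| ≤ gammaSeq v₁ v₂ 1 t / σ) {n : ℕ} (hn : 1 ≤ n) :
    ∀ t ∈ Icc 0 T, |z n t| ≤ gammaSeq v₁ v₂ n t / σ ^ n := by
  induction n using Nat.strong_induction_on with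
  | _ n ih =>
    rcases hn.eq_or_lt with rfl | hn
    · simpa using hone
    intro t ht
    have hsub : uIcc 0 t ⊆ Ici 0 := by rw [uIcc_of_le ht.1]; exact Icc_subset_Ici_self
    have hk : Continuous fun s => kernel v₁ v₂ t s := by unfold kernel; fun_prop
    have hzc : ContinuousOn (fun s => ∑ j ∈ Finset.Ico 1 n, z j s * z (n - j) s) (Ici 0) := by
      refine continuousOn_finsetSum _ fun j hj => ?_
      rw [Finset.mem_Ico] at hj
      exact (hz j hj.1).mul (hz (n - j) (by omega))
    have hgc : Continuous fun s => ∑ j ∈ Finset.Ico 1 n,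
        gammaSeq v₁ v₂ j s * gammaSeq v₁ v₂ (n - j) s := by
      refine continuous_finsetSum _ fun j hj => ?_
      rw [Finset.mem_Ico] at hj
      exact (continuous_gammaSeq h₁ h₂ hj.1).mul (continuous_gammaSeq h₁ h₂ (by omega))
    rw [hrec n hn t ht.1, gammaSeq_of_two_le v₁ v₂ n hn t, ← intervalIntegral.integral_div]
    refine (intervalIntegral.abs_integral_le_integral_abs ht.1).trans ?_
    refine intervalIntegral.integral_mono_on ht.1
      ((hk.continuousOn.mul (hzc.mono hsub)).abs.intervalIntegrable)
      (((hk.abs.mul hgc).div_const _).intervalIntegrable _ _) fun s hs => ?_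
    rw [abs_mul, mul_div_assoc, Finset.sum_div]
    refine mul_le_mul_of_nonneg_left ((Finset.abs_sum_le_sum_abs _ _).trans
      (Finset.sum_le_sum fun j hj => ?_)) (abs_nonneg _)
    rw [Finset.mem_Ico] at hj
    have hs' : s ∈ Icc 0 T := ⟨hs.1, hs.2.trans ht.2⟩
    have e1 := ih j hj.2 hj.1 s hs'
    have e2 := ih (n - j) (by omega) (by omega) s hs'
    rw [abs_mul]
    -- The first upper bound is nonnegative because it dominates an absolute value, so no sign of
    -- `σ` enters. The powers combine as `σ ^ j * σ ^ (n - j) = σ ^ n`.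
    refine (mul_le_mul e1 e2 (abs_nonneg _) ((abs_nonneg _).trans e1)).trans_eq ?_
    rw [div_mul_div_comm, ← pow_add, Nat.add_sub_cancel' hj.2.le]

end Pathwise

/-! ### Doob's inequality for Gaussian sums -/

section Probability

variable {Ω : Type*} [MeasurableSpace Ω] {P : Measure Ω}

/-- By symmetry the integral folds onto the half-line, where it is a Gamma integral with `Γ(1) = 1`;
variance 0 is a point mass. -/
theorem integral_abs_gaussianReal (v : ℝ≥0) :
    ∫ x, |x| ∂gaussianReal 0 v = Real.sqrt (2 / Real.pi) * Real.sqrt v := by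
  rcases eq_or_ne v 0 with rfl | hv
  · simp
  have hv' : (0 : ℝ) < v := by positivity
  rw [integral_gaussianReal_eq_integral_smul hv]
  have h1 : (fun x : ℝ => gaussianPDFReal 0 v x • |x|) =
      fun x => (fun r : ℝ => (Real.sqrt (2 * Real.pi * v))⁻¹ *
        (r ^ (1 : ℝ) * Real.exp (-(1 / (2 * v)) * r ^ (2 : ℝ)))) |x| := by
    funext x
    simp only [gaussianPDFReal, smul_eq_mul, Real.rpow_one, Real.rpow_two, sq_abs, sub_zero]
    rw [show -(1 / (2 * (v : ℝ))) * x ^ 2 = -x ^ 2 / (2 * v) by ring]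
    ring
  rw [h1, integral_comp_abs (f := fun r : ℝ => (Real.sqrt (2 * Real.pi * v))⁻¹ *
        (r ^ (1 : ℝ) * Real.exp (-(1 / (2 * v)) * r ^ (2 : ℝ)))), integral_const_mul,
    integral_rpow_mul_exp_neg_mul_rpow (by norm_num) (by norm_num) (by positivity)]
  rw [show (-(1 + 1) / 2 : ℝ) = -1 by norm_num, show ((1 + 1) / 2 : ℝ) = 1 by norm_num,
    Real.Gamma_one, Real.rpow_neg_one, one_div, inv_inv, Real.sqrt_div (by norm_num),
    Real.sqrt_mul (by positivity), Real.sqrt_mul (by positivity)]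
  have hs : Real.sqrt (v : ℝ) ^ 2 = v := Real.sq_sqrt hv'.le
  have h2 : Real.sqrt (2 : ℝ) ^ 2 = 2 := Real.sq_sqrt (by norm_num)
  have h3 : 0 < Real.sqrt (v : ℝ) := Real.sqrt_pos.2 hv'
  have h4 : 0 < Real.sqrt Real.pi := Real.sqrt_pos.2 Real.pi_pos
  field_simp
  rw [hs, h2]

/-- The shift to `n + 1` terms makes the `n`-th sum end with `Y n`, hence adapted. The next
increment is independent of the past and centred. -/
theorem martingale_sum [IsProbabilityMeasure P] {Y : ℕ → Ω → ℝ}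
    (hm : ∀ i, StronglyMeasurable (Y i)) (hY : iIndepFun Y P) (hi : ∀ i, Integrable (Y i) P)
    (h0 : ∀ i, ∫ ω, Y i ω ∂P = 0) :
    Martingale (fun n => ∑ j ∈ Finset.range (n + 1), Y j) (Filtration.natural Y hm) P := by
  refine martingale_of_condExp_sub_eq_zero_nat (fun n => ?_) (fun n => ?_) fun n => ?_
  · refine Finset.stronglyMeasurable_sum _ fun j hj => ?_
    exact ((Filtration.stronglyAdapted_natural hm) j).mono
      ((Filtration.natural Y hm).mono (Nat.lt_succ_iff.1 (Finset.mem_range.1 hj)))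
  · exact integrable_finsetSum' _ fun j _ => hi j
  · have h := hY.condExp_natural_ae_eq_of_lt hm (Nat.lt_succ_self n)
    rw [Finset.sum_range_succ _ (n + 1), add_sub_cancel_left]
    refine h.trans ?_
    simp only [h0]
    rfl

theorem mul_measure_exists_le_abs_sum_le_aux [IsProbabilityMeasure P] {Y : ℕ → Ω → ℝ}
    (hm : ∀ i, StronglyMeasurable (Y i)) (hY : iIndepFun Y P) (hi : ∀ i, Integrable (Y i) P)
    (h0 : ∀ i, ∫ ω, Y i ω ∂P = 0) {ε : ℝ≥0} (hε : 0 < ε) (N : ℕ) :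
    ε * P {ω | ∃ k ≤ N, (ε : ℝ) ≤ |∑ j ∈ Finset.range k, Y j ω|} ≤
      ENNReal.ofReal (∫ ω, |∑ j ∈ Finset.range N, Y j ω| ∂P) := by
  rcases N with _ | N
  · have : {ω | ∃ k ≤ 0, (ε : ℝ) ≤ |∑ j ∈ Finset.range k, Y j ω|} = ∅ := by
      ext ω
      simpa using hε
    rw [this]
    simp
  have hM := martingale_sum hm hY hi h0
  -- The absolute value of a martingale is the supremum of two submartingales, `M` and `-M`.
  have hsub := hM.submartingale.sup hM.neg.submartingale
  have hmax := maximal_ineq hsub (fun n ω => by simpa using le_total _ _) (ε := ε) N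
  have habs : ∀ n ω, ((fun n => ∑ j ∈ Finset.range (n + 1), Y j) ⊔
      -(fun n => ∑ j ∈ Finset.range (n + 1), Y j)) n ω =
      |∑ j ∈ Finset.range (n + 1), Y j ω| := fun n ω => by
    simp [abs, Finset.sum_apply]
  simp only [habs] at hmax
  refine (mul_le_mul_right (measure_mono ?_) _).trans (hmax.trans (ENNReal.ofReal_le_ofReal ?_))
  · rintro ω ⟨k, hk, hle⟩
    rcases k with _ | k
    · rw [Finset.sum_range_zero, abs_zero] at hle
      exact absurd hle (not_le.2 hε)
    · have hk' : k ∈ Finset.range (N + 1) := Finset.mem_range.2 (by omega)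
      exact (Finset.le_sup'_iff (f := fun k => |∑ j ∈ Finset.range (k + 1), Y j ω|) _).2
        ⟨k, hk', hle⟩
  · exact setIntegral_le_integral
      ((integrable_finsetSum _ fun j _ => hi j).abs) (Filter.Eventually.of_forall fun _ => abs_nonneg _)

/-- Doob's maximal inequality for sums of independent centred random variables. -/
theorem mul_measure_exists_le_abs_sum_le [IsProbabilityMeasure P] {Y : ℕ → Ω → ℝ}
    (hY : iIndepFun Y P) (hi : ∀ i, Integrable (Y i) P)
    (h0 : ∀ i, ∫ ω, Y i ω ∂P = 0) {ε : ℝ≥0} (hε : 0 < ε) (N : ℕ) :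
    ε * P {ω | ∃ k ≤ N, (ε : ℝ) ≤ |∑ j ∈ Finset.range k, Y j ω|} ≤
      ENNReal.ofReal (∫ ω, |∑ j ∈ Finset.range N, Y j ω| ∂P) := by
  -- The natural filtration needs strongly measurable variables, so each `Y i` is replaced by such a
  -- version.
  have hae : ∀ i, Y i =ᵐ[P] (hi i).1.mk (Y i) := fun i => (hi i).1.ae_eq_mk
  have hall : ∀ᵐ ω ∂P, ∀ i, Y i ω = (hi i).1.mk (Y i) ω := ae_all_iff.2 hae
  have key := mul_measure_exists_le_abs_sum_le_aux (P := P)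
    (fun i => (hi i).1.stronglyMeasurable_mk) (hY.congr hae) (fun i => (hi i).congr (hae i))
    (fun i => (integral_congr_ae (hae i)).symm.trans (h0 i)) hε N
  have h1 : {ω | ∃ k ≤ N, (ε : ℝ) ≤ |∑ j ∈ Finset.range k, Y j ω|} =ᵐ[P]
      {ω | ∃ k ≤ N, (ε : ℝ) ≤ |∑ j ∈ Finset.range k, (hi j).1.mk (Y j) ω|} := by
    filter_upwards [hall] with ω hω
    change (∃ k ≤ N, _ ≤ |∑ j ∈ Finset.range k, Y j ω|) =
      (∃ k ≤ N, _ ≤ |∑ j ∈ Finset.range k, (hi j).1.mk (Y j) ω|)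
    simp only [hω]
  have h2 : ∫ ω, |∑ j ∈ Finset.range N, Y j ω| ∂P =
      ∫ ω, |∑ j ∈ Finset.range N, (hi j).1.mk (Y j) ω| ∂P := by
    refine integral_congr_ae ?_
    filter_upwards [hall] with ω hω
    simp only [hω]
  rw [measure_congr h1, h2]
  exact key

theorem hasLaw_sum_gaussianReal [IsProbabilityMeasure P] {Y : ℕ → Ω → ℝ} {v : ℕ → ℝ≥0}
    (hY : iIndepFun Y P) (hl : ∀ i, HasLaw (Y i) (gaussianReal 0 (v i)) P) (N : ℕ) :
    HasLaw (∑ j ∈ Finset.range N, Y j) (gaussianReal 0 (∑ j ∈ Finset.range N, v j)) P := by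
  induction N with
  | zero =>
    refine ⟨by rw [Finset.range_zero, Finset.sum_empty]; exact aemeasurable_const (b := (0 : ℝ)), ?_⟩
    simp only [Finset.range_zero, Finset.sum_empty, gaussianReal_zero_var]
    exact Measure.map_const P (0 : ℝ) |>.trans (by simp)
  | succ N ih =>
    rw [Finset.sum_range_succ, Finset.sum_range_succ]
    refine ⟨ih.aemeasurable.add (hl N).aemeasurable, ?_⟩
    have h := gaussianReal_add_gaussianReal_of_indepFun
      (hY.indepFun_finsetSum_of_notMem₀ (fun i => (hl i).aemeasurable)
        (Finset.notMem_range_self (n := N))) ih.map_eq (hl N).map_eq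
    rwa [add_zero] at h

/-- The final sum is Gaussian with the summed variance, so the first absolute moment in Doob's bound
is exact; this is the source of `√(2/π)`. -/
theorem measureReal_exists_le_abs_sum_gaussian_le [IsProbabilityMeasure P] {Y : ℕ → Ω → ℝ}
    {v : ℕ → ℝ≥0} (hY : iIndepFun Y P) (hl : ∀ i, HasLaw (Y i) (gaussianReal 0 (v i)) P)
    {ε : ℝ} (hε : 0 < ε) (N : ℕ) :
    P.real {ω | ∃ k ≤ N, ε ≤ |∑ j ∈ Finset.range k, Y j ω|} ≤
      Real.sqrt (2 / Real.pi) * Real.sqrt (∑ j ∈ Finset.range N, (v j : ℝ)) / ε := by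
  lift ε to ℝ≥0 using hε.le
  have hi : ∀ i, Integrable (Y i) P := fun i => by
    have := (hl i).hasGaussianLaw
    exact this.integrable
  have h0 : ∀ i, ∫ ω, Y i ω ∂P = 0 := fun i => by
    rw [(hl i).integral_eq, integral_id_gaussianReal]
  have key := mul_measure_exists_le_abs_sum_le hY hi h0 (NNReal.coe_pos.1 hε) N
  have hint : ∫ ω, |∑ j ∈ Finset.range N, Y j ω| ∂P =
      Real.sqrt (2 / Real.pi) * Real.sqrt (∑ j ∈ Finset.range N, (v j : ℝ)) := by
    have hL := hasLaw_sum_gaussianReal hY hl N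
    have := hL.integral_comp (f := fun x : ℝ => |x|) (by fun_prop)
    simp only [Function.comp_def, Finset.sum_apply] at this
    rw [this, integral_abs_gaussianReal]
    push_cast
    rfl
  rw [hint] at key
  rw [le_div_iff₀' hε]
  have := ENNReal.toReal_le_of_le_ofReal (by positivity) key
  simpa [ENNReal.toReal_mul, Measure.real] using this

end Probability

/-! ### Uniform convergence of Riemann sums -/

section Riemann

variable {w b g : ℝ → ℝ} {T : ℝ}

/-- The points of the uniform partition of `[0, T]` into `N` intervals. -/
noncomputable def grid (T : ℝ) (N k : ℕ) : ℝ := k / N * T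

theorem grid_zero (T : ℝ) (N : ℕ) : grid T N 0 = 0 := by simp [grid]

theorem grid_self (T : ℝ) {N : ℕ} (hN : N ≠ 0) : grid T N N = T := by
  rw [grid, div_self (Nat.cast_ne_zero.2 hN), one_mul]

theorem grid_succ_sub (T : ℝ) (N k : ℕ) : grid T N (k + 1) - grid T N k = T / N := by
  simp only [grid]
  push_cast
  ring

theorem grid_mono (hT : 0 ≤ T) (N : ℕ) : Monotone (grid T N) := fun i j hij => by
  unfold grid
  gcongr

theorem grid_mem_Icc (hT : 0 ≤ T) {N k : ℕ} (hN : N ≠ 0) (hk : k ≤ N) :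
    grid T N k ∈ Icc 0 T :=
  ⟨(grid_zero T N).symm.trans_le (grid_mono hT N (Nat.zero_le k)),
    (grid_mono hT N hk).trans_eq (grid_self T hN)⟩

theorem abs_sub_sub_sum_le {m s : ℕ → ℝ} {δ : ℝ} {N : ℕ}
    (h : ∀ k < N, |m (k + 1) - m k - s k| ≤ δ) {k : ℕ} (hk : k ≤ N) :
    |m k - m 0 - ∑ j ∈ Finset.range k, s j| ≤ k * δ := by
  induction k with
  | zero => simp
  | succ k ih =>
    have h1 := ih (Nat.le_of_succ_le hk)
    have h2 := h k hk
    rw [Finset.sum_range_succ]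
    have e : m (k + 1) - m 0 - (∑ j ∈ Finset.range k, s j + s k) =
        (m k - m 0 - ∑ j ∈ Finset.range k, s j) + (m (k + 1) - m k - s k) := by ring
    rw [e]
    refine (abs_add_le _ _).trans ?_
    push_cast
    linarith

/-- Uniform continuity on `[0, T]`. The left endpoint serves ordinary Riemann sums, the right one
the sums for `∫ w db`. -/
theorem eventually_grid_oscillation_le (hg : Continuous g) (hT : 0 ≤ T) {ε : ℝ} (hε : 0 < ε) :
    ∀ᶠ N : ℕ in Filter.atTop, N ≠ 0 ∧ ∀ k < N, ∀ s ∈ Icc (grid T N k) (grid T N (k + 1)),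
      |g s - g (grid T N k)| ≤ ε ∧ |g (grid T N (k + 1)) - g s| ≤ ε := by
  have hu := isCompact_Icc.uniformContinuousOn_of_continuous (hg.continuousOn (s := Icc 0 T))
  obtain ⟨δ, hδ, hu⟩ := Metric.uniformContinuousOn_iff.1 hu ε hε
  filter_upwards [Filter.eventually_ne_atTop 0,
    (tendsto_const_div_atTop_nhds_zero_nat T).eventually (gt_mem_nhds hδ)] with N hN0 hN
  refine ⟨hN0, fun k hk s hs => ?_⟩
  have h1 := grid_mem_Icc hT hN0 hk.le
  have h2 := grid_mem_Icc hT hN0 (Nat.succ_le_of_lt hk)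
  have h3 : s ∈ Icc 0 T := ⟨h1.1.trans hs.1, hs.2.trans h2.2⟩
  have h4 := grid_succ_sub T N k
  constructor
  · refine (hu s h3 _ h1 ?_).le
    rw [Real.dist_eq, abs_of_nonneg (by linarith [hs.1])]
    linarith [hs.2]
  · refine (hu _ h2 s h3 ?_).le
    rw [Real.dist_eq, abs_of_nonneg (by linarith [hs.2])]
    linarith [hs.1]

theorem tendsto_riemann_sum (hg : Continuous g) (hT : 0 ≤ T) :
    Filter.Tendsto (fun N : ℕ => ∑ j ∈ Finset.range N, g (grid T N j) * (T / N)) Filter.atTop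
      (nhds (∫ s in (0 : ℝ)..T, g s)) := by
  rw [Metric.tendsto_nhds]
  intro ε hε
  -- The `N` local errors add up to `ε T / (T + 1)`, which is strictly below `ε`.
  have hε' : 0 < ε / (T + 1) := by positivity
  filter_upwards [eventually_grid_oscillation_le hg hT hε'] with N ⟨hN0, hN⟩
  have hN' : (0 : ℝ) < N := by positivity
  have key := abs_sub_sub_sum_le (m := fun k => ∫ s in (0 : ℝ)..grid T N k, g s)
    (s := fun j => g (grid T N j) * (T / N)) (δ := ε / (T + 1) * (T / N)) (N := N)
    (fun k hk => ?_) le_rfl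
  · simp only [grid_zero, grid_self T hN0, intervalIntegral.integral_same, sub_zero] at key
    rw [Real.dist_eq, abs_sub_comm]
    refine key.trans_lt ?_
    have e : (N : ℝ) * (ε / (T + 1) * (T / N)) = ε * (T / (T + 1)) := by field_simp
    rw [e]
    exact mul_lt_of_lt_one_right hε ((div_lt_one (by positivity)).2 (by linarith))
  · have hle := grid_mono hT N (Nat.le_succ k)
    have e : (∫ s in (0 : ℝ)..grid T N (k + 1), g s) - (∫ s in (0 : ℝ)..grid T N k, g s) -
        g (grid T N k) * (T / N) =
        ∫ s in grid T N k..grid T N (k + 1), (g s - g (grid T N k)) := by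
      rw [intervalIntegral.integral_interval_sub_left (hg.intervalIntegrable _ _)
        (hg.intervalIntegrable _ _), intervalIntegral.integral_sub (hg.intervalIntegrable _ _)
        (continuous_const.intervalIntegrable _ _), intervalIntegral.integral_const, smul_eq_mul, grid_succ_sub,
        mul_comm (T / N)]
    simp only [e]
    rw [← Real.norm_eq_abs]
    refine (intervalIntegral.norm_integral_le_of_norm_le_const (C := ε / (T + 1))
      fun s hs => ?_).trans_eq ?_
    · rw [uIoc_of_le hle] at hs
      exact (hN k hk s (Ioc_subset_Icc_self hs)).1
    · rw [grid_succ_sub, abs_of_nonneg (by positivity)]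

theorem continuous_pathIntegral (hw : Differentiable ℝ w) (hw' : Continuous (deriv w))
    (hb : Continuous b) : Continuous (pathIntegral w b) :=
  (hw.continuous.mul hb).sub (continuous_primitive (hw'.mul hb))

/-- The Riemann sums of `∫ w db` along the uniform partitions converge uniformly. -/
theorem eventually_abs_pathIntegral_sub_sum_le (hw : Differentiable ℝ w)
    (hw' : Continuous (deriv w)) (hb : Continuous b) (hb0 : b 0 = 0) (hT : 0 ≤ T) {ε : ℝ}
    (hε : 0 < ε) :
    ∀ᶠ N : ℕ in Filter.atTop, ∀ k ≤ N, |pathIntegral w b (grid T N k) -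
      ∑ j ∈ Finset.range k, w (grid T N j) * (b (grid T N (j + 1)) - b (grid T N j))| ≤ ε := by
  obtain ⟨C, hC⟩ := isCompact_Icc.exists_bound_of_continuousOn (hw'.continuousOn (s := Icc 0 T))
  have hC0 : 0 ≤ C := (norm_nonneg _).trans (hC 0 ⟨le_rfl, hT⟩)
  have hε' : 0 < ε / (C * T + 1) := by positivity
  filter_upwards [eventually_grid_oscillation_le hb hT hε'] with N ⟨hN0, hN⟩ k hk
  have hN' : (0 : ℝ) < N := by positivity
  have key := abs_sub_sub_sum_le (m := fun k => pathIntegral w b (grid T N k))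
    (s := fun j => w (grid T N j) * (b (grid T N (j + 1)) - b (grid T N j)))
    (δ := C * (ε / (C * T + 1)) * (T / N)) (N := N) (fun k hk => ?_) hk
  · have h0 : pathIntegral w b 0 = 0 := by simp [pathIntegral, hb0]
    simp only [grid_zero, h0, sub_zero] at key
    refine key.trans ?_
    have hkN : (k : ℝ) ≤ N := Nat.cast_le.2 hk
    calc (k : ℝ) * (C * (ε / (C * T + 1)) * (T / N))
        ≤ N * (C * (ε / (C * T + 1)) * (T / N)) := by gcongr
      _ = ε * (C * T / (C * T + 1)) := by field_simp
      _ ≤ ε * 1 := by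
        refine mul_le_mul_of_nonneg_left ?_ hε.le
        exact (div_le_one (by positivity)).2 (by linarith)
      _ = ε := mul_one ε
  · have hle := grid_mono hT N (Nat.le_succ k)
    have hwb : Continuous fun s => deriv w s * b s := hw'.mul hb
    have hwc : Continuous fun s => deriv w s * b (grid T N (k + 1)) := hw'.mul continuous_const
    -- Writing the increment of `w` as the integral of `deriv w` moves all the roughness of `b` into
    -- an oscillation, so mere continuity of `b` suffices.
    have e : pathIntegral w b (grid T N (k + 1)) - pathIntegral w b (grid T N k) -
        w (grid T N k) * (b (grid T N (k + 1)) - b (grid T N k)) =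
        ∫ s in grid T N k..grid T N (k + 1), deriv w s * (b (grid T N (k + 1)) - b s) := by
      have h1 := intervalIntegral.integral_interval_sub_left
        (hwb.intervalIntegrable (μ := volume) 0 (grid T N (k + 1)))
        (hwb.intervalIntegrable 0 (grid T N k))
      have h2 := intervalIntegral.integral_deriv_eq_sub (f := w) (a := grid T N k)
        (b := grid T N (k + 1)) (fun x _ => hw x) (hw'.intervalIntegrable _ _)
      simp only [mul_sub]
      rw [intervalIntegral.integral_sub (hwc.intervalIntegrable _ _)
        (hwb.intervalIntegrable _ _), intervalIntegral.integral_mul_const, h2, ← h1]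
      simp only [pathIntegral]
      ring
    simp only [e]
    rw [← Real.norm_eq_abs]
    refine (intervalIntegral.norm_integral_le_of_norm_le_const (C := C * (ε / (C * T + 1)))
      fun s hs => ?_).trans_eq ?_
    · rw [uIoc_of_le hle] at hs
      have hs' : s ∈ Icc 0 T := ⟨(grid_mem_Icc hT hN0 hk.le).1.trans hs.1.le,
        hs.2.trans (grid_mem_Icc hT hN0 (Nat.succ_le_of_lt hk)).2⟩
      rw [norm_mul]
      exact mul_le_mul (hC s hs') (hN k hk s (Ioc_subset_Icc_self hs)).2 (norm_nonneg _) hC0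
    · rw [grid_succ_sub, abs_of_nonneg (by positivity)]

/-- The strict excess over `ε` is split into two halves `δ`: one pays for moving `t` to the grid
point of index `⌊t / T * N⌋₊`, the other for replacing the integral by its sum. -/
theorem eventually_exists_le_abs_sum (hw : Differentiable ℝ w)
    (hw' : Continuous (deriv w)) (hb : Continuous b) (hb0 : b 0 = 0) (hT : 0 < T) {ε t : ℝ}
    (ht : t ∈ Icc 0 T) (hε : ε < |pathIntegral w b t|) :
    ∀ᶠ N : ℕ in Filter.atTop, ∃ k ≤ N, ε ≤ |∑ j ∈ Finset.range k,
      w (grid T N j) * (b (grid T N (j + 1)) - b (grid T N j))| := by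
  set δ := (|pathIntegral w b t| - ε) / 2 with hδ
  have hδ0 : 0 < δ := by rw [hδ]; linarith
  have hlim : Filter.Tendsto (fun N : ℕ => |pathIntegral w b (grid T N ⌊t / T * N⌋₊)|)
      Filter.atTop (nhds |pathIntegral w b t|) := by
    refine ((continuous_pathIntegral hw hw' hb).abs.tendsto t).comp ?_
    have h := ((tendsto_nat_floor_mul_div_atTop (div_nonneg ht.1 hT.le)).comp
      (tendsto_natCast_atTop_atTop (R := ℝ))).mul_const T
    rwa [div_mul_cancel₀ _ hT.ne'] at h
  filter_upwards [eventually_abs_pathIntegral_sub_sum_le hw hw' hb hb0 hT.le hδ0,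
    hlim.eventually (lt_mem_nhds (show |pathIntegral w b t| - δ < _ by linarith))] with N h1 h2
  have hk : ⌊t / T * N⌋₊ ≤ N := by
    refine Nat.floor_le_of_le (mul_le_of_le_one_left (Nat.cast_nonneg N) ?_)
    exact (div_le_one hT).2 ht.2
  refine ⟨_, hk, ?_⟩
  have h3 := h1 _ hk
  have h4 := abs_sub_abs_le_abs_sub (pathIntegral w b (grid T N ⌊t / T * N⌋₊))
    (∑ j ∈ Finset.range ⌊t / T * N⌋₊,
      w (grid T N j) * (b (grid T N (j + 1)) - b (grid T N j)))
  linarith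

theorem L2norm_eq_sqrt (hw : Continuous w) (hT : 0 ≤ T) :
    L2norm T w = Real.sqrt (∫ s in (0 : ℝ)..T, w s ^ 2) := by
  have hm : MemLp w 2 (volume.restrict (Icc 0 T)) := by
    rw [memLp_two_iff_integrable_sq hw.aestronglyMeasurable]
    exact (hw.pow 2).continuousOn.integrableOn_Icc
  rw [L2norm, MemLp.eLpNorm_eq_integral_rpow_norm two_ne_zero ENNReal.ofNat_ne_top hm,
    ENNReal.toReal_ofReal (by positivity), intervalIntegral.integral_of_le hT,
    ← integral_Icc_eq_integral_Ioc, Real.sqrt_eq_rpow]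
  simp

end Riemann

/-! ### The maximal inequality for Wiener integrals -/

section Maximal

variable {Ω : Type*} [MeasurableSpace Ω] {P : Measure Ω}

/-- A Fatou argument: the events of lying in every `A N` with `N ≥ m` increase with `m`, and each
has measure at most `lim p`. Continuity from below requires no measurability here. -/
theorem measureReal_le_of_eventually_mem [IsProbabilityMeasure P] {s : Set Ω} {A : ℕ → Set Ω}
    {p : ℕ → ℝ} {l : ℝ} (hs : ∀ᵐ ω ∂P, ω ∈ s → ∀ᶠ N in Filter.atTop, ω ∈ A N)
    (hA : ∀ N, P.real (A N) ≤ p N) (hp : Filter.Tendsto p Filter.atTop (nhds l)) :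
    P.real s ≤ l := by
  set D : ℕ → Set Ω := fun m => {ω | ∀ N, m ≤ N → ω ∈ A N} with hD
  have hmono : Monotone D := fun i j hij ω hω N hN => hω N (hij.trans hN)
  have h1 : P s ≤ P (⋃ m, D m) := by
    refine measure_mono_ae ?_
    filter_upwards [hs] with ω hω hωs
    obtain ⟨m, hm⟩ := Filter.eventually_atTop.1 (hω hωs)
    exact mem_iUnion.2 ⟨m, hm⟩
  have h2 : ∀ m, P.real (D m) ≤ l := fun m => by
    refine ge_of_tendsto hp ?_
    filter_upwards [Filter.eventually_ge_atTop m] with N hN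
    exact (measureReal_mono (s₁ := D m) fun ω hω => hω N hN).trans (hA N)
  have hl : 0 ≤ l := measureReal_nonneg.trans (h2 0)
  refine ENNReal.toReal_le_of_le_ofReal hl (h1.trans ?_)
  rw [hmono.measure_iUnion]
  refine iSup_le fun m => ?_
  rw [← ENNReal.ofReal_toReal (measure_ne_top P (D m))]
  exact ENNReal.ofReal_le_ofReal (h2 m)

/-- A maximal inequality for the Wiener integral of a continuously differentiable function. -/
theorem measureReal_exists_lt_abs_pathIntegral_le [IsProbabilityMeasure P]
    {B : ℝ≥0 → Ω → ℝ} (hB : IsBrownianReal B P) {w : ℝ → ℝ} (hw : Differentiable ℝ w)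
    (hw' : Continuous (deriv w)) {T : ℝ} (hT : 0 < T) {ε : ℝ} (hε : 0 < ε) :
    P.real {ω | ∃ t ∈ Icc 0 T, ε < |pathIntegral w (fun t => B t.toNNReal ω) t|} ≤
      Real.sqrt (2 / Real.pi) * L2norm T w / ε := by
  have hlim := tendsto_riemann_sum (hw.continuous.pow 2) hT.le
  refine measureReal_le_of_eventually_mem (A := fun N => {ω | ∃ k ≤ N, ε ≤
      |∑ j ∈ Finset.range k, w (grid T N j) *
        (B (grid T N (j + 1)).toNNReal ω - B (grid T N j).toNNReal ω)|})
    (p := fun N => Real.sqrt (2 / Real.pi) * Real.sqrt (∑ j ∈ Finset.range N,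
      w (grid T N j) ^ 2 * (T / N)) / ε) ?_ (fun N => ?_) ?_
  · filter_upwards [hB.cont, hB.eval_zero_ae_eq_zero] with ω hc h0 ⟨t, ht, hlt⟩
    exact eventually_exists_le_abs_sum hw hw' (hc.comp continuous_real_toNNReal)
      (by simpa using h0) hT ht hlt
  · set τ : ℕ → ℝ≥0 := fun j => (grid T N j).toNNReal with hτ
    have hτm : Monotone τ := fun i j hij => Real.toNNReal_mono (grid_mono hT.le N hij)
    have hind : iIndepFun (fun j ω => w (grid T N j) * (B (τ (j + 1)) ω - B (τ j) ω)) P :=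
      (hB.hasIndepIncrements.nat hτm).comp (fun j x => w (grid T N j) * x) fun j => by fun_prop
    have hlaw := fun j => gaussianReal_const_mul (hB.hasLaw_sub (τ (j + 1)) (τ j)) (w (grid T N j))
    simp only [mul_zero, Pi.sub_apply] at hlaw
    have h := measureReal_exists_le_abs_sum_gaussian_le hind hlaw hε N
    refine h.trans_eq ?_
    -- The variances `w² |τ (j + 1) - τ j|` are the terms of a Riemann sum for `∫ w²`.
    congr 3
    refine Finset.sum_congr rfl fun j _ => ?_
    have hτc : ∀ j, ((τ j : ℝ≥0) : ℝ) = grid T N j := fun j =>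
      Real.coe_toNNReal _ ((grid_zero T N).symm.trans_le (grid_mono hT.le N (Nat.zero_le j)))
    change w (grid T N j) ^ 2 * |((τ (j + 1) : ℝ≥0) : ℝ) - ((τ j : ℝ≥0) : ℝ)| = _
    rw [hτc, hτc, grid_succ_sub, abs_of_nonneg (by positivity)]
  · rw [L2norm_eq_sqrt hw.continuous hT.le]
    exact ((hlim.sqrt).const_mul _).div_const _

end Maximal

/-- On the event that both Wiener integrals stay below `1 / σ`, all the coefficients of the
expansion satisfy their bounds. -/
theorem ae_forall_abs_le_gammaSeq_div {Ω : Type*} [MeasurableSpace Ω] {P : Measure Ω}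
    {B : ℝ≥0 → Ω → ℝ} (hB : IsBrownianReal B P) {X x₀ v₁ v₂ : ℝ → ℝ} (hX : Continuous X)
    (hx₀ : EqOn x₀ X (Ici 0)) (hv₁ : Differentiable ℝ v₁) (hv₂ : Differentiable ℝ v₂)
    (hv₁' : ∀ t, HasDerivAt (deriv v₁) (2 * X t * v₁ t) t)
    (hv₂' : ∀ t, HasDerivAt (deriv v₂) (2 * X t * v₂ t) t)
    (hW : ∀ t, 0 ≤ t → v₁ t * deriv v₂ t - deriv v₁ t * v₂ t = 1)
    {x : ℕ → ℝ → Ω → ℝ} (hx : IsExpansion P B x₀ x) (σ T : ℝ) {n : ℕ} (hn : 1 ≤ n) :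
    ∀ᵐ ω ∂P,
      (∀ t ∈ Icc 0 T, |pathIntegral v₁ (fun t => B t.toNNReal ω) t| ≤ 1 / σ) →
      (∀ t ∈ Icc 0 T, |pathIntegral v₂ (fun t => B t.toNNReal ω) t| ≤ 1 / σ) →
      ∀ t ∈ Icc 0 T, |x n t ω| ≤ gammaSeq v₁ v₂ n t / σ ^ n := by
  -- Countably many equations share a single null set, as the induction uses all lower coefficients
  -- at one `ω`.
  have hhigher : ∀ᵐ ω ∂P, ∀ n, 2 ≤ n → SolvesLinearized x₀
      (fun t => ∫ s in (0 : ℝ)..t, ∑ j ∈ Finset.Ico 1 n, x j s ω * x (n - j) s ω)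
      (fun t => x n t ω) := ae_all_iff.2 fun n => by
    by_cases h : 2 ≤ n
    · filter_upwards [hx.higher n h] with ω hω _ using hω
    · exact Filter.Eventually.of_forall fun _ h' => absurd h' h
  filter_upwards [hx.first, hhigher, hB.cont] with ω h1 h2 hc hb₁ hb₂
  have hzc : ∀ n, 1 ≤ n → ContinuousOn (fun t => x n t ω) (Ici 0) := fun n hn => by
    rcases hn.eq_or_lt with rfl | hn
    · exact h1.continuousOn
    · exact (h2 n hn).continuousOn
  have hbc : Continuous fun t : ℝ => B t.toNNReal ω := hc.comp continuous_real_toNNReal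
  refine abs_le_gammaSeq_div (z := fun n t => x n t ω) hv₁.continuous hv₂.continuous hzc
    (fun n hn t ht => ?_) (fun t ht => ?_) hn
  · refine (h2 n hn).eq_integral_kernel hX hx₀ ?_ hv₁ hv₂ hv₁' hv₂' hW ht
    refine continuousOn_finsetSum _ fun j hj => ?_
    rw [Finset.mem_Ico] at hj
    exact (hzc j hj.1).mul (hzc (n - j) (by omega))
  · rw [h1.eq_pathIntegral hX hx₀ hbc.continuousOn hv₁ hv₂ hv₁' hv₂' hW ht.1, gammaSeq]
    refine (abs_sub _ _).trans ?_
    simp only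
    rw [abs_mul, abs_mul, add_comm |v₁ t|, add_div, div_eq_mul_one_div |v₂ t|,
      div_eq_mul_one_div |v₁ t|]
    exact add_le_add (mul_le_mul_of_nonneg_left (hb₁ t ht) (abs_nonneg _))
      (mul_le_mul_of_nonneg_left (hb₂ t ht) (abs_nonneg _))

end CubicOscillator

/-! ### The probability estimate -/

theorem mainTheorem3 {Ω : Type*} [MeasurableSpace Ω] (P : Measure Ω) [IsProbabilityMeasure P]
    (B : ℝ≥0 → Ω → ℝ) (hB : IsBrownianReal B P)
    (a c y η : ℝ) (hcb : c < -a - c) (hba : -a - c < a) (hy : y ∈ Set.Icc c (-a - c))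
    (hη : CubicOscillator.hamiltonian (CubicOscillator.calB a c) y η = a * c * (a + c) / 3)
    (x₀ : ℝ → ℝ)
    (hx₀ : CubicOscillator.IsUnperturbedSolution (CubicOscillator.calB a c) y η x₀)
    (w₁ w₂ : ℝ → ℝ) (k₁ k₂ : ℝ)
    (hw₁ : w₁ = CubicOscillator.w₁ a c y η k₁) (hw₂ : w₂ = CubicOscillator.w₂ a c y η k₂)
    (hW : ∀ t, 0 ≤ t → w₁ t * deriv w₂ t - deriv w₁ t * w₂ t = 1)
    (x : ℕ → ℝ → Ω → ℝ) (hx : CubicOscillator.IsExpansion P B x₀ x)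
    (σ : ℝ) (hσ : 0 < σ) (T : ℝ) (hT : 0 < T) (n : ℕ) (hn : 1 ≤ n) :
    1 - σ * 2 ^ (n - 2) * Real.sqrt (2 / Real.pi) *
        (CubicOscillator.L2norm T w₁ + CubicOscillator.L2norm T w₂) ≤
      P.real {ω | ∀ t ∈ Set.Icc (0 : ℝ) T,
        |x n t ω| ≤ CubicOscillator.gammaSeq w₁ w₂ n t / σ ^ n} := by
  open CubicOscillator in
  have hX : Continuous (snSolution a c y η) :=
    continuous_iff_continuousAt.2 fun t => (hasDerivAt_snSolution hcb hba t).continuousAt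
  have hd₁ : Differentiable ℝ w₁ := hw₁ ▸ fun t => (hasDerivAt_w₁ hcb hba k₁ t).differentiableAt
  have hd₂ : Differentiable ℝ w₂ := hw₂ ▸ fun t => (hasDerivAt_w₂ hcb hba k₂ t).differentiableAt
  have hw₁' : ∀ t, HasDerivAt (deriv w₁) (2 * snSolution a c y η t * w₁ t) t :=
    hw₁ ▸ hasDerivAt_deriv_w₁ hcb hba k₁
  have hw₂' : ∀ t, HasDerivAt (deriv w₂) (2 * snSolution a c y η t * w₂ t) t :=
    hw₂ ▸ hasDerivAt_deriv_w₂ hcb hba k₂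
  have hc₁ : Continuous (deriv w₁) := continuous_iff_continuousAt.2 fun t => (hw₁' t).continuousAt
  have hc₂ : Continuous (deriv w₂) := continuous_iff_continuousAt.2 fun t => (hw₂' t).continuousAt
  have hae := ae_forall_abs_le_gammaSeq_div hB hX
    (hx₀.eqOn (isUnperturbedSolution_snSolution hcb hba hy hη)) hd₁ hd₂ hw₁' hw₂' hW hx σ T hn
  have hσ' : 0 < 1 / σ := one_div_pos.2 hσ
  have hP₁ := measureReal_exists_lt_abs_pathIntegral_le hB hd₁ hc₁ hT hσ'
  have hP₂ := measureReal_exists_lt_abs_pathIntegral_le hB hd₂ hc₂ hT hσ'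
  set A := {ω | ∀ t ∈ Set.Icc (0 : ℝ) T, |x n t ω| ≤ gammaSeq w₁ w₂ n t / σ ^ n}
  set D₁ := {ω | ∃ t ∈ Icc 0 T, 1 / σ < |pathIntegral w₁ (fun t => B t.toNNReal ω) t|}
  set D₂ := {ω | ∃ t ∈ Icc 0 T, 1 / σ < |pathIntegral w₂ (fun t => B t.toNNReal ω) t|}
  -- Covering the space by `A`, `D₁` and `D₂` and using subadditivity avoids complements, hence any
  -- measurability of these events.
  have hcover : P univ ≤ P (A ∪ (D₁ ∪ D₂)) := by
    refine measure_mono_ae ?_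
    filter_upwards [hae] with ω hω _
    by_cases h₁ : ω ∈ D₁
    · exact Or.inr (Or.inl h₁)
    by_cases h₂ : ω ∈ D₂
    · exact Or.inr (Or.inr h₂)
    · refine Or.inl (hω (fun t ht => ?_) fun t ht => ?_)
      · exact not_lt.1 fun h => h₁ ⟨t, ht, h⟩
      · exact not_lt.1 fun h => h₂ ⟨t, ht, h⟩
  have h1 : 1 ≤ P.real A + (P.real D₁ + P.real D₂) := by
    have h := ENNReal.toReal_mono (measure_ne_top P _) hcover
    rw [measure_univ, ENNReal.toReal_one] at h
    exact h.trans ((measureReal_union_le _ _).trans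
      (add_le_add_right (measureReal_union_le _ _) _))
  rw [div_div_eq_mul_div, div_one] at hP₁ hP₂
  -- The argument proves the bound without the power of 2, which is at least 1 and only weakens it;
  -- truncated subtraction gives the exponent `(n - 2)⁺`.
  have h2 : (1 : ℝ) ≤ 2 ^ (n - 2) := one_le_pow₀ (by norm_num)
  have h3 : 0 ≤ σ * Real.sqrt (2 / Real.pi) * (L2norm T w₁ + L2norm T w₂) :=
    mul_nonneg (by positivity) (add_nonneg ENNReal.toReal_nonneg ENNReal.toReal_nonneg)
  have h4 := le_mul_of_one_le_left h3 h2
  linarith
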